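/- Conventions. For a strict partition $\lambda=(\lambda_1>\dots>\lambda_k>0)$, its shifted shape has $\lambda_r$ boxes in row $r$, and row $r$ is shifted $r-1$ units to the right. For strict partitions $\mu\subseteq\lambda$, a shifted semistandard tableau of shape $\lambda/\mu$ is a filling of $\lambda/\mu$ with letters of the alphabet $1'<1<2'<2<\cdots$ that is weakly increasing along rows and down columns, with at most one $i$ in each column and at most one $i'$ in each row, for every $i$. It is in canonical form if, for every $i$, the first of the letters $i,i'$ that occurs in the reading order (rows from bottom to top, each from left to right) is unprimed. It is of straight shape if $\mu=\emptyset$. Write $\mathbf a$ for a letter $a$ or $a'$; a box is an $\mathbf a$-box if it contains $a$ or $a'$. Let $T$ be such a tableau and $b=a+1$. The shifted tableau switching of $(T^{a},T^{b})$ repeats the following step until no $\mathbf a$-box has a $\mathbf b$-box directly to its right or directly below it. Among the $\mathbf a$-boxes that have a $\mathbf b$-box directly to their right or directly below, let $x$ be the rightmost one that contains $a$ or, if none of them contains $a$, the bottommost one (which contains $a'$). If $x$ has exactly one such adjacent $\mathbf b$-box, exchange $x$ with it. If it has two, exchange $x$ with the right one if that one contains $b'$, and with the lower one otherwise. There are two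 exceptions. (i) If $x=(r,r)$ is on the main diagonal, $(r,r+1)$ contains $b'$ and $(r+1,r+1)$ is a $\mathbf b$-box, then the contents of $(r,r)$ and $(r+1,r+1)$ are exchanged and the letter in $(r,r+1)$ becomes $b$. (ii) If $x=(r,r+1)$ contains $a$, $(r,r)$ is an $\mathbf a$-box, $(r+1,r+1)$ is a $\mathbf b$-box and $(r,r+2)$ does not contain $b'$, then the contents of $(r,r)$ and $(r+1,r+1)$ are exchanged and the letter in $(r,r+1)$ becomes $a'$. For $i\ge 1$, the shifted Bender--Knuth move $\mathsf t_i$ sends $T$ to the tableau obtained from $T$ by the shifted tableau switching of $(T^{i},T^{i+1})$, the other letters being left unchanged, followed by the exchange of names $i\leftrightarrow i+1$, $i'\leftrightarrow(i+1)'$. Let $\mathcal{X}$ be either the class of all shifted semistandard tableaux in canonical form, of any skew shape $\lambda/\mu$, or the class of those of any straight shape. The shifted Berenstein--Kirillov group $\mathcal{SBK}$ is the group with generators $\mathsf t_i$, $i\ge1$, subject to all the relations that the moves $\mathsf t_i$ satisfy when acting on the tableaux in $\mathcal{X}$. That is, the relations are $u=v$ for all words $u,v$ in the generators whose composites agree on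 every tableau in $\mathcal{X}$. For $n\geq 1$, $\mathcal{SBK}_n$ is the subgroup generated by $\mathsf t_1,\dots,\mathsf t_{n-1}$, and for $i \geq 1$ let $$\mathsf q_i:=\mathsf t_1(\mathsf t_2\mathsf t_1)\cdots(\mathsf t_i\mathsf t_{i-1}\cdots\mathsf t_1).$$ Lemma. For either choice of $\mathcal{X}$, the following holds in $\mathcal{SBK}$: $$\mathsf t_1=\mathsf q_1,\qquad \mathsf t_2=\mathsf q_1\mathsf q_2\mathsf q_1,\qquad \mathsf t_i=\mathsf q_{i-1}\mathsf q_i\mathsf q_{i-1}\mathsf q_{i-2}\quad\text{for } i>2.$$ Consequently, $\mathsf q_1,\dots,\mathsf q_{n-1}$ generate $\mathcal{SBK}_n$, for every $n\ge1$. -/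

import Mathlib

namespace ShiftedBK

/-! ### Strict partitions, shifted shapes, fillings -/

/-- A strict partition `λ₁ > ⋯ > λₖ > 0` (possibly empty). -/
structure StrictPartition where
  parts : List ℕ
  decreasing : parts.Pairwise (fun a b => b < a)
  positive : ∀ a ∈ parts, 0 < a

/-- The empty partition. -/
def StrictPartition.empty : StrictPartition where
  parts := []
  decreasing := List.Pairwise.nil
  positive := by simp

/-- A box `(row, column)`; rows (top to bottom) and columns (left to right) are numbered from `0`,
so that the main diagonal consists of the boxes `(r, r)`. -/
abbrev Box := ℕ × ℕ

/-- The shifted shape `S(λ)`: row `r` has `λ_r` boxes and is shifted `r` units to the right. -/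
def StrictPartition.shape (l : StrictPartition) : Set Box :=
  {x | x.1 ≤ x.2 ∧ x.2 < x.1 + l.parts.getD x.1 0}

/-- A letter `i'` (`primed = true`) or `i` (`primed = false`), with `i ≥ 1`. -/
@[ext] structure Letter where
  idx : ℕ+
  primed : Bool

/-- The order `1' ≤ 1 ≤ 2' ≤ 2 ≤ ⋯` on the primed alphabet. -/
def Letter.le (x y : Letter) : Prop :=
  x.idx < y.idx ∨ (x.idx = y.idx ∧ (x.primed = true ∨ y.primed = false))

/-- A filling of some boxes of the plane by letters (`none` marks the boxes that are not filled). -/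
abbrev Filling := Box → Option Letter

/-- `IsIn T a x`: the box `x` of `T` is an **a**-box, i.e. it contains `a` or `a'`. -/
def IsIn (T : Filling) (a : ℕ+) (x : Box) : Prop := ∃ l, T x = some l ∧ l.idx = a

/-- `x` comes before `y` in reading order: rows from bottom to top, each from left to right. -/
def ReadsBefore (x y : Box) : Prop := y.1 < x.1 ∨ (x.1 = y.1 ∧ x.2 < y.2)

/-- `T` is a shifted semistandard tableau of shape `l / m`, in canonical form. -/
structure IsShST (l m : StrictPartition) (T : Filling) : Prop where
  subset : m.shape ⊆ l.shape
  filled : ∀ x, T x ≠ none ↔ x ∈ l.shape \ m.shape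
  row_weak : ∀ r c d x y, c < d → T (r, c) = some x → T (r, d) = some y → x.le y
  col_weak : ∀ r s c x y, r < s → T (r, c) = some x → T (s, c) = some y → x.le y
  /-- at most one `i` per column -/
  col_unprimed : ∀ i r s c, T (r, c) = some ⟨i, false⟩ → T (s, c) = some ⟨i, false⟩ → r = s
  /-- at most one `i'` per row -/
  row_primed : ∀ i r c d, T (r, c) = some ⟨i, true⟩ → T (r, d) = some ⟨i, true⟩ → c = d
  /-- the first occurrence, in reading order, of a letter `i` or `i'` is unprimed -/
  canonical : ∀ x l, T x = some l → (∀ y, ReadsBefore y x → ¬ IsIn T l.idx y) → l.primed = false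

/-- All shifted semistandard tableaux of skew shape in canonical form. -/
def skewTableaux : Set Filling := {T | ∃ l m, IsShST l m T}

/-- All shifted semistandard tableaux of straight shape in canonical form. -/
def straightTableaux : Set Filling := {T | ∃ l, IsShST l StrictPartition.empty T}

/-! ### Shifted tableau switching of the letters `a` and `b` -/

/-- The box to the right of `x`. -/
def right (x : Box) : Box := (x.1, x.2 + 1)

/-- The box below `x`. -/
def below (x : Box) : Box := (x.1 + 1, x.2)

/-- `x` is an **a**-box that has a **b**-box to its right or below it. -/
def CanSwitch (T : Filling) (a b : ℕ+) (x : Box) : Prop :=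
  IsIn T a x ∧ (IsIn T b (right x) ∨ IsIn T b (below x))

/-- No **a**-box can be switched with a **b**-box. -/
def FullySwitched (T : Filling) (a b : ℕ+) : Prop := ∀ x, ¬ CanSwitch T a b x

/-- `x` is the box to be switched next: the rightmost switchable `a`-box if there is one, and
otherwise the bottommost switchable `a'`-box. -/
def IsNext (T : Filling) (a b : ℕ+) (x : Box) : Prop :=
  CanSwitch T a b x ∧
    ((T x = some ⟨a, false⟩ ∧
        ∀ y, CanSwitch T a b y → T y = some ⟨a, false⟩ → y.2 ≤ x.2) ∨
      ((∀ y, CanSwitch T a b y → T y ≠ some ⟨a, false⟩) ∧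
        ∀ y, CanSwitch T a b y → y.1 ≤ x.1))

/-- Exchange the contents of two boxes. -/
def exchange (T : Filling) (x y : Box) : Filling := T ∘ Equiv.swap x y

/-- `x` is an `a`-box whose left neighbour is an **a**-box on the main diagonal. -/
def AfterDiagonal (T : Filling) (a : ℕ+) (x : Box) : Prop :=
  x.2 = x.1 + 1 ∧ T x = some ⟨a, false⟩ ∧ IsIn T a (x.1, x.1)

open Classical in
/-- The switch applied at the **a**-box `x`. A **b**-box adjacent to `x` lies to its right or
below it. The matrices show the boxes concerned; `.` is a place below the main diagonal. -/
noncomputable def switchAt (T : Filling) (a b : ℕ+) (x : Box) : Filling :=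
  if IsIn T b (right x) ∧ IsIn T b (below x) then
    if T (right x) = some ⟨b, true⟩ then
      -- (S5)  [**a** b' ; **b**]  ↦  [b' **a** ; **b**]
      exchange T x (right x)
    else if AfterDiagonal T a x then
      -- (S7)  [**a** a b ; . **b**]  ↦  [**b** a' b ; . **a**]
      Function.update (exchange T (x.1, x.1) (below x)) x (some ⟨a, true⟩)
    else
      -- (S6)  [**a** b ; **b**]  ↦  [**b** b ; **a**]
      exchange T x (below x)
  else if IsIn T b (right x) then
    if x.1 = x.2 ∧ T (right x) = some ⟨b, true⟩ ∧ IsIn T b (below (right x)) then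
      -- (S3)  [**a** b' ; . **b**]  ↦  [**b** b ; . **a**]
      Function.update (exchange T x (below (right x))) (right x) (some ⟨b, false⟩)
    else
      -- (S1)  [**a** **b**]  ↦  [**b** **a**]
      exchange T x (right x)
  else
    if AfterDiagonal T a x then
      -- (S4)  [**a** a ; . **b**]  ↦  [**b** a' ; . **a**]
      Function.update (exchange T (x.1, x.1) (below x)) x (some ⟨a, true⟩)
    else
      -- (S2)  [**a** ; **b**]  ↦  [**b** ; **a**]
      exchange T x (below x)

open Classical in
/-- One step of the shifted switching process (nothing happens if there is no box to switch). -/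
noncomputable def switchStep (a b : ℕ+) (T : Filling) : Filling :=
  if h : ∃ x, IsNext T a b x then switchAt T a b h.choose else T

/-- The shifted switching process: `m` steps, with `m` the least integer for which the result is
fully switched. The boxes with letters other than **a** and **b** do not change. -/
noncomputable def switching (a b : ℕ+) (T : Filling) : Filling :=
  (switchStep a b)^[sInf {m : ℕ | FullySwitched ((switchStep a b)^[m] T) a b}] T

/-! ### Shifted Bender–Knuth moves and the shifted Berenstein–Kirillov group -/

/-- Apply the transposition `(i, i+1)` to the letters of `T`, keeping the primes. -/
def relabel (i : ℕ+) (T : Filling) : Filling :=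
  fun x => (T x).map fun l => ⟨Equiv.swap i (i + 1) l.idx, l.primed⟩

/-- The shifted Bender–Knuth move `𝗍ᵢ`: switch `(Tⁱ, Tⁱ⁺¹)` and swap the names of the letters. -/
noncomputable def benderKnuth (i : ℕ+) (T : Filling) : Filling :=
  relabel i (switching i (i + 1) T)

/-- The composite `𝗍_{i₁} ∘ ⋯ ∘ 𝗍_{iₖ}` for a word `[i₁, …, iₖ]`. -/
noncomputable def actWord (u : List ℕ+) (T : Filling) : Filling :=
  u.foldr benderKnuth T

/-- The relations satisfied by the moves on the tableaux of the class `X`: the elements `u v⁻¹`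
of the free group, for all words `u`, `v` whose composites agree on every tableau in `X`. -/
def relations (X : Set Filling) : Set (FreeGroup ℕ+) :=
  {g | ∃ u v : List ℕ+, (∀ T ∈ X, actWord u T = actWord v T) ∧
    g = (u.map FreeGroup.of).prod * ((v.map FreeGroup.of).prod)⁻¹}

/-- The shifted Berenstein–Kirillov group of the class `X` of tableaux: the free group on the
`𝗍ᵢ`, `i > 0`, modulo the relations that they satisfy when they act on the tableaux in `X`. -/
abbrev SBK (X : Set Filling) : Type := PresentedGroup (relations X)

/-- The generator `𝗍ᵢ` of `SBK`. -/
def t (X : Set Filling) (i : ℕ+) : SBK X := PresentedGroup.of i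

/-- `𝗉ᵢ = 𝗍ᵢ 𝗍ᵢ₋₁ ⋯ 𝗍₁`. -/
def p (X : Set Filling) (i : ℕ+) : SBK X :=
  ((List.range i).reverse.map fun k => t X k.succPNat).prod

/-- `𝗊ᵢ = 𝗍₁ (𝗍₂ 𝗍₁) ⋯ (𝗍ᵢ 𝗍ᵢ₋₁ ⋯ 𝗍₁)`. -/
def q (X : Set Filling) (i : ℕ+) : SBK X :=
  ((List.range i).map fun k => p X k.succPNat).prod

/-- The subgroup `SBKₙ` generated by `𝗍₁, …, 𝗍ₙ₋₁`. -/
def SBKn (X : Set Filling) (n : ℕ) : Subgroup (SBK X) :=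
  Subgroup.closure {g | ∃ i : ℕ+, (i : ℕ) ≤ n - 1 ∧ g = t X i}

end ShiftedBK

namespace ShiftedBK

/-! ### Linear extensions of skew shifted shapes -/

/-! The formulas follow formally from two kinds of relations: $t_i^2=1$, and $t_it_j=t_jt_i$ for
$|i-j|>1$. With $p_n=t_n\cdots t_1$ and $q_n=q_{n-1}p_n$, they give $p_nq_n=q_{n-1}$
(`pNat_mul_qNat`) and then $q_n^2=1$. Hence $p_n=q_{n-1}q_n$, and
$t_n=p_np_{n-1}^{-1}=q_{n-1}q_nq_{n-1}q_{n-2}$. The commutations hold on every filling, because the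
two moves act on disjoint sets of boxes and each reads only its own letters. The substance is that
$t_i$ is an involution on tableaux (`benderKnuth_benderKnuth`).

This is proved by standardization. The boxes of one letter are ordered with the primed ones first,
from top to bottom, followed by the unprimed ones, from left to right. The $a$-boxes followed by the
$b$-boxes then form a linear extension of a skew shifted shape. On linear extensions there is a
standard switching, which moves each inner entry past all outer ones, last inner entry first. It is
composed of elementary switches of two consecutive boxes, each of which is its own inverse, so
standard switching is an involution (`passAll_passAll`).

It remains to see that shifted switching induces standard switching on the underlying boxes
(`Standard.switching`). Its choice of the next box and of the neighbour follows the standard orders.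
The exceptions (i) and (ii) are the places where the order of the letters survives but a prime must
change: no primed letter may stand on the diagonal, and an $a$ waiting at $(r,r)$ becomes $a'$ once
its successor has moved to $(r+1,r+1)$. The geometric reason is `pass_pair_cols`. The modified
fillings need not occur in the actual process, so the two are compared only through their later
common values (`Joins`).

Finally, the primes can be recovered from the order of the boxes (`eq_of_boxes_eq`), so the
involution on boxes lifts to fillings. This argument only uses the standard orders of the two
letters, so it is not necessary to know that $t_i$ sends tableaux to tableaux. -/

/-- `x` and `y` are horizontal or vertical neighbours. -/
def Adj (x y : Box) : Prop := y = right x ∨ y = below x ∨ x = right y ∨ x = below y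

instance : DecidableRel Adj := fun x y => by unfold Adj; infer_instance

theorem Adj.symm {x y : Box} (h : Adj x y) : Adj y x := by
  unfold Adj at *; tauto

/-- `w` lists the boxes of a skew shifted shape, each box after the boxes to its upper left. -/
structure LinExt (w : List Box) : Prop where
  valid : ∀ x ∈ w, x.1 ≤ x.2
  order : w.Pairwise fun x y => ¬ y ≤ x
  convex : ∀ x ∈ w, ∀ z ∈ w, ∀ y : Box, x ≤ y → y ≤ z → y.1 ≤ y.2 → y ∈ w

theorem LinExt.infix {A B C : List Box} (h : LinExt (A ++ B ++ C)) : LinExt B := by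
  have ho := h.order
  rw [List.pairwise_append, List.pairwise_append] at ho
  refine ⟨fun x hx => h.valid x (by simp [hx]), ho.1.2.1, fun x hx z hz y hxy hyz hy => ?_⟩
  have := h.convex x (by simp [hx]) z (by simp [hz]) y hxy hyz hy
  simp only [List.mem_append] at this
  rcases this with (hA | hB) | hC
  · exact absurd hxy (ho.1.2.2 y hA x hx)
  · exact hB
  · exact absurd hyz (ho.2.2 z (by simp [hz]) y hC)

theorem LinExt.of_cons {x : Box} {w : List Box} (h : LinExt (x :: w)) : LinExt w :=
  LinExt.infix (A := [x]) (C := []) (by simpa using h)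

/-- A box between `x` and `y` in the plane is between `x` and `y` in the list. -/
theorem LinExt.mem_between {A B C : List Box} {x y b : Box} (h : LinExt (A ++ x :: B ++ y :: C))
    (hx : x ≤ b) (hy : b ≤ y) (hb : b.1 ≤ b.2) : b = x ∨ b ∈ B ∨ b = y := by
  have h' : LinExt (x :: B ++ [y]) := LinExt.infix (A := A) (C := C) (by simpa using h)
  have := h'.convex x (by simp) y (by simp) b hx hy hb
  simpa [or_assoc] using this

/-- By convexity, the box directly above or directly to the left of `y` would be listed between `x`
and `y` unless it is `x` itself. This is the main geometric input: two consecutive boxes are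
neighbours or incomparable. -/
theorem LinExt.next_of_le {A C : List Box} {x y : Box} (h : LinExt (A ++ x :: y :: C))
    (hxy : x ≤ y) : y = right x ∨ y = below x := by
  have hb : ∀ b, x ≤ b → b ≤ y → b.1 ≤ b.2 → b = x ∨ b = y := fun b h1 h2 h3 => by
    simpa using LinExt.mem_between (A := A) (B := []) (C := C) (by simpa using h) h1 h2 h3
  have hvx := h.valid x (by simp)
  have hvy := h.valid y (by simp)
  have hne : ¬ y ≤ x := by
    have ho := h.order
    rw [List.pairwise_append] at ho
    exact (List.pairwise_cons.1 ho.2.1).1 y (by simp)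
  obtain ⟨r, c⟩ := x
  obtain ⟨s, d⟩ := y
  simp only [right, below, Prod.mk.injEq, Prod.mk_le_mk] at *
  rcases Nat.lt_or_ge r s with hrs | hrs
  · have := hb (s - 1, d) (by constructor <;> simp <;> omega) (by constructor <;> simp) (by simp; omega)
    simp only [Prod.mk.injEq] at this
    omega
  · have := hb (s, d - 1) (by constructor <;> simp <;> omega) (by constructor <;> simp) (by simp; omega)
    simp only [Prod.mk.injEq] at this
    omega

theorem LinExt.swap {A C : List Box} {x y : Box} (h : LinExt (A ++ x :: y :: C))
    (hxy : ¬ Adj x y) : LinExt (A ++ y :: x :: C) := by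
  have hle : ¬ x ≤ y := fun hle => hxy (by
    rcases h.next_of_le hle with h | h <;> simp [Adj, h])
  have hm : ∀ b, b ∈ A ++ y :: x :: C ↔ b ∈ A ++ x :: y :: C := fun b => by
    simp only [List.mem_append, List.mem_cons]; tauto
  refine ⟨fun b hb => h.valid b ((hm b).1 hb), ?_, fun a ha c hc b h1 h2 h3 =>
    (hm b).2 (h.convex a ((hm a).1 ha) c ((hm c).1 hc) b h1 h2 h3)⟩
  have ho := h.order
  simp only [List.pairwise_append, List.pairwise_cons, List.mem_cons] at ho ⊢
  refine ⟨ho.1, ⟨?_, fun b hb => ho.2.1.1 b (.inr hb), ho.2.1.2.2⟩, fun a ha b hb =>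
    ho.2.2 a ha b (by tauto)⟩
  rintro b (rfl | hb)
  · exact hle
  · exact ho.2.1.2.1 b hb

theorem LinExt.nodup {w : List Box} (h : LinExt w) : w.Nodup :=
  h.order.imp fun {x y} hxy (he : x = y) => hxy he.ge

/-! ### Standard switching -/

/-- The elementary switch of consecutive boxes `x`, `y`: the pair of the new places of the letters
in `y` and `x`. -/
def elemSwitch (x y : Box) : Box × Box := if Adj x y then (x, y) else (y, x)

theorem elemSwitch_elemSwitch (x y : Box) :
    elemSwitch (elemSwitch x y).1 (elemSwitch x y).2 = (x, y) := by
  by_cases h : Adj x y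
  · simp [elemSwitch, h]
  · have h' : ¬ Adj y x := fun h' => h h'.symm
    simp [elemSwitch, h, h']

theorem LinExt.elemSwitch {A C : List Box} {x y : Box} (h : LinExt (A ++ x :: y :: C)) :
    LinExt (A ++ (ShiftedBK.elemSwitch x y).1 :: (ShiftedBK.elemSwitch x y).2 :: C) := by
  by_cases hxy : Adj x y
  · simpa [ShiftedBK.elemSwitch, hxy] using h
  · simpa [ShiftedBK.elemSwitch, hxy] using h.swap hxy

/-- The box `x` is switched with the boxes of a list, one after the other. -/
def pass : Box → List Box → List Box × Box
  | x, [] => ([], x)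
  | x, y :: ys =>
    ((elemSwitch x y).1 :: (pass (elemSwitch x y).2 ys).1, (pass (elemSwitch x y).2 ys).2)

/-- The boxes of `xs`, the last one first, are switched with those of `ys`; `S` accumulates the
results for the boxes of `xs`. -/
def passAll (xs ys S : List Box) : List Box × List Box :=
  xs.foldr (fun x r => ((pass x r.1).1, (pass x r.1).2 :: r.2)) (ys, S)

theorem passAll_concat (xs : List Box) (x : Box) (ys S : List Box) :
    passAll (xs ++ [x]) ys S = passAll xs (pass x ys).1 ((pass x ys).2 :: S) := by
  simp [passAll]

theorem passAll_cons (x : Box) (xs ys S : List Box) :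
    passAll (x :: xs) ys S =
      ((pass x (passAll xs ys S).1).1, (pass x (passAll xs ys S).1).2 :: (passAll xs ys S).2) := rfl

/-- Undoes a single pass: the elementary switches are repeated in the opposite order, and each is
its own inverse. -/
theorem passAll_pass (x : Box) (ys : List Box) :
    passAll (pass x ys).1 [(pass x ys).2] [] = ([x], ys) := by
  induction ys generalizing x with
  | nil => rfl
  | cons y ys ih => simp [pass, passAll_cons, ih, elemSwitch_elemSwitch]

/-- The elementary switches form a rectangular grid, which `passAll` evaluates row by row. Here its
first column is split off instead, which gives the transposed recursion needed to invert the
process. -/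
theorem passAll_cons_right (Y : List Box) (u : Box) (X : List Box) {v : Box} {Y₁ : List Box}
    (h : passAll Y [u] [] = ([v], Y₁)) :
    passAll Y (u :: X) [] = (v :: (passAll Y₁ X []).1, (passAll Y₁ X []).2) := by
  induction Y generalizing v Y₁ with
  | nil =>
    simp only [passAll, List.foldr_nil, Prod.mk.injEq, List.cons.injEq, and_true] at h
    obtain ⟨rfl, rfl⟩ := h
    simp [passAll]
  | cons y Y ih =>
    rcases hp : passAll Y [u] [] with ⟨V, Y'⟩
    rw [passAll_cons, hp] at h
    match V with
    | [] => simp [pass] at h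
    | _ :: _ :: _ => simp [pass] at h
    | [v₀] =>
      simp only [pass, Prod.mk.injEq, List.cons.injEq, and_true] at h
      obtain ⟨h1, h2⟩ := h
      subst h1 h2
      simp [passAll_cons, ih hp, pass]

theorem passAll_passAll (xs ys : List Box) :
    passAll (passAll xs ys []).1 (passAll xs ys []).2 [] = (xs, ys) := by
  induction xs generalizing ys with
  | nil =>
    simp only [passAll, List.foldr_nil]
    induction ys with
    | nil => rfl
    | cons y ys ih => simp [ih, pass]
  | cons x xs ih =>
    rw [passAll_cons]
    simp only
    rw [passAll_cons_right _ _ _ (passAll_pass x _), ih]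

theorem pass_eq_self {x : Box} {ys : List Box} (h : ∀ y ∈ ys, ¬ Adj x y) : pass x ys = (ys, x) := by
  induction ys generalizing x with
  | nil => rfl
  | cons y ys ih =>
    have := ih (x := x) fun y' h' => h y' (by simp [h'])
    simp [pass, elemSwitch, h y (by simp), this]

theorem LinExt.pass {A ys C : List Box} {x : Box} (h : LinExt (A ++ x :: ys ++ C)) :
    LinExt (A ++ (ShiftedBK.pass x ys).1 ++ (ShiftedBK.pass x ys).2 :: C) := by
  induction ys generalizing A x with
  | nil => simpa [ShiftedBK.pass] using h
  | cons y ys ih =>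
    have := LinExt.elemSwitch (A := A) (C := ys ++ C) (x := x) (y := y) (by simpa using h)
    simpa [ShiftedBK.pass] using ih (A := A ++ [(ShiftedBK.elemSwitch x y).1]) (by simpa using this)

/-! ### Two boxes passing a list -/

/-- Two successive entries, the first in a higher row, keep this order when both are switched past
`y`. -/
theorem elemSwitch_pair_rows {x₁ x₂ y : Box} {C : List Box} (h : LinExt (x₁ :: x₂ :: y :: C))
    (hr : x₁.1 < x₂.1) :
    (elemSwitch x₁ (elemSwitch x₂ y).1).2.1 < (elemSwitch x₂ y).2.1 := by
  have hm : ∀ b : Box, x₁ ≤ b → b ≤ y → b.1 ≤ b.2 → b = x₁ ∨ b = x₂ ∨ b = y := fun b h1 h2 h3 => by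
    simpa using LinExt.mem_between (A := []) (B := [x₂]) (C := C) (by simpa using h) h1 h2 h3
  have hm2 : ∀ b : Box, x₂ ≤ b → b ≤ y → b.1 ≤ b.2 → b = x₂ ∨ b = y := fun b h1 h2 h3 => by
    simpa using LinExt.mem_between (A := [x₁]) (B := []) (C := C) (by simpa using h) h1 h2 h3
  have hv1 := h.valid x₁ (by simp)
  have hv2 := h.valid x₂ (by simp)
  have hvy := h.valid y (by simp)
  have ho := h.order
  simp only [List.pairwise_cons, List.mem_cons] at ho
  have o1 := ho.1 x₂ (by simp)
  have o2 := ho.1 y (by simp)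
  have o3 := ho.2.1 y (by simp)
  clear ho h
  obtain ⟨r₁, c₁⟩ := x₁
  obtain ⟨r₂, c₂⟩ := x₂
  obtain ⟨s, d⟩ := y
  -- The only boxes for which convexity is needed are the left and upper neighbours of `y`; the rest
  -- is a finite case analysis on coordinates.
  have e1 := hm (s, d - 1)
  have e2 := hm (s - 1, d)
  have e3 := hm2 (s, d - 1)
  have e4 := hm2 (s - 1, d)
  clear hm hm2
  by_cases k1 : Adj (r₂, c₂) (s, d)
  · by_cases k2 : Adj (r₁, c₁) (r₂, c₂) <;>
    · simp only [elemSwitch, k1, k2, if_true, if_false]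
      simp only [Adj, right, below, Prod.mk.injEq, Prod.mk_le_mk] at *
      omega
  · by_cases k2 : Adj (r₁, c₁) (s, d) <;>
    · simp only [elemSwitch, k1, k2, if_true, if_false]
      simp only [Adj, right, below, Prod.mk.injEq, Prod.mk_le_mk] at *
      omega

/-- Unlike for rows, there is an exception: in the corner $(r,r),(r,r+1),(r+1,r+1)$ both entries end
in column $r+1$. Away from the diagonal it cannot occur, since the box below `x₁` would have to be
listed as well. -/
theorem elemSwitch_pair_cols {x₁ x₂ y : Box} {C : List Box} (h : LinExt (x₁ :: x₂ :: y :: C))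
    (hc : x₁.2 < x₂.2) :
    (elemSwitch x₁ (elemSwitch x₂ y).1).2.2 < (elemSwitch x₂ y).2.2 ∨
    (x₁.1 = x₁.2 ∧ x₂ = right x₁ ∧ y = below x₂) := by
  have hm : ∀ b : Box, x₁ ≤ b → b ≤ y → b.1 ≤ b.2 → b = x₁ ∨ b = x₂ ∨ b = y := fun b h1 h2 h3 => by
    simpa using LinExt.mem_between (A := []) (B := [x₂]) (C := C) (by simpa using h) h1 h2 h3
  have hm2 : ∀ b : Box, x₂ ≤ b → b ≤ y → b.1 ≤ b.2 → b = x₂ ∨ b = y := fun b h1 h2 h3 => by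
    simpa using LinExt.mem_between (A := [x₁]) (B := []) (C := C) (by simpa using h) h1 h2 h3
  have hv1 := h.valid x₁ (by simp)
  have hv2 := h.valid x₂ (by simp)
  have hvy := h.valid y (by simp)
  have ho := h.order
  simp only [List.pairwise_cons, List.mem_cons] at ho
  have o1 := ho.1 x₂ (by simp)
  have o2 := ho.1 y (by simp)
  have o3 := ho.2.1 y (by simp)
  clear ho h
  obtain ⟨r₁, c₁⟩ := x₁
  obtain ⟨r₂, c₂⟩ := x₂
  obtain ⟨s, d⟩ := y
  have e1 := hm (s, d - 1)
  have e2 := hm (s - 1, d)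
  have e3 := hm2 (s, d - 1)
  have e4 := hm2 (s - 1, d)
  clear hm hm2
  by_cases k1 : Adj (r₂, c₂) (s, d)
  · by_cases k2 : Adj (r₁, c₁) (r₂, c₂) <;>
    · simp only [elemSwitch, k1, k2, if_true, if_false]
      simp only [Adj, right, below, Prod.mk.injEq, Prod.mk_le_mk] at *
      omega
  · by_cases k2 : Adj (r₁, c₁) (s, d) <;>
    · simp only [elemSwitch, k1, k2, if_true, if_false]
      simp only [Adj, right, below, Prod.mk.injEq, Prod.mk_le_mk] at *
      omega

theorem LinExt.elemSwitch_pair {x₁ x₂ y : Box} {C : List Box} (h : LinExt (x₁ :: x₂ :: y :: C)) :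
    LinExt ((ShiftedBK.elemSwitch x₁ (ShiftedBK.elemSwitch x₂ y).1).2 ::
      (ShiftedBK.elemSwitch x₂ y).2 :: C) := by
  have h1 := LinExt.elemSwitch (A := [x₁]) (by simpa using h)
  have h2 := LinExt.elemSwitch (A := []) (by simpa using h1)
  exact h2.of_cons

theorem pass_pair_rows {x₁ x₂ : Box} {ys : List Box} (h : LinExt (x₁ :: x₂ :: ys))
    (hr : x₁.1 < x₂.1) : (pass x₁ (pass x₂ ys).1).2.1 < (pass x₂ ys).2.1 := by
  induction ys generalizing x₁ x₂ with
  | nil => simpa [pass] using hr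
  | cons y ys ih =>
    simpa [pass] using ih h.elemSwitch_pair (elemSwitch_pair_rows h hr)

theorem elemSwitch_snd_ge {A C : List Box} {x y : Box} (h : LinExt (A ++ x :: y :: C)) :
    x ≤ (elemSwitch x y).2 := by
  by_cases hxy : Adj x y
  · have ho := h.order
    simp only [List.pairwise_append, List.pairwise_cons, List.mem_cons] at ho
    have := ho.2.1.1 y (by simp)
    simp only [elemSwitch, hxy, if_true]
    rcases hxy with rfl | rfl | rfl | rfl
    · exact ⟨le_rfl, Nat.le_succ _⟩
    · exact ⟨Nat.le_succ _, le_rfl⟩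
    · exact absurd ⟨le_rfl, Nat.le_succ _⟩ this
    · exact absurd ⟨Nat.le_succ _, le_rfl⟩ this
  · simp [elemSwitch, hxy]

theorem pass_snd_ge {A ys C : List Box} {x : Box} (h : LinExt (A ++ x :: ys ++ C)) :
    x ≤ (pass x ys).2 := by
  induction ys generalizing A x with
  | nil => exact le_rfl
  | cons y ys ih =>
    have h1 := LinExt.elemSwitch (A := A) (C := ys ++ C) (x := x) (y := y) (by simpa using h)
    exact (elemSwitch_snd_ge (A := A) (C := ys ++ C) (by simpa using h)).trans
      (ih (A := A ++ [(elemSwitch x y).1]) (by simpa using h1))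

theorem pass_snd_mem (x : Box) (ys : List Box) : (pass x ys).2 = x ∨ (pass x ys).2 ∈ ys := by
  induction ys generalizing x with
  | nil => simp [pass]
  | cons y ys ih =>
    rcases ih (elemSwitch x y).2 with h | h
    · by_cases hxy : Adj x y
      · right; simp [pass, h]; simp [elemSwitch, hxy]
      · left; simp [pass, h]; simp [elemSwitch, hxy]
    · right; simp [pass, h]

/-! ### Primed boxes -/

/-- A box together with the information whether its letter is primed. -/
abbrev LBox := Box × Bool

/-- The relation of consecutive boxes in the list of the boxes with one letter: the primed ones
from top to bottom, then the unprimed ones from left to right. -/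
def Follows (u v : LBox) : Prop :=
  (u.2 = true → u.1.1 < v.1.1) ∧ (u.2 = false → v.2 = false ∧ u.1.2 < v.1.2)

/-- The relation of not necessarily consecutive boxes in such a list. -/
def Precedes (u v : LBox) : Prop :=
  (v.2 = true → u.2 = true ∧ u.1.1 < v.1.1) ∧ (u.2 = false → v.2 = false ∧ u.1.2 < v.1.2)

theorem Follows.precedes {u v : LBox} (h : Follows u v) : Precedes u v := by
  obtain ⟨u, p⟩ := u
  obtain ⟨v, q⟩ := v
  cases p <;> cases q <;> simp_all [Follows, Precedes]

instance : IsTrans LBox Precedes := ⟨fun u v w h1 h2 => by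
  obtain ⟨u, p⟩ := u
  obtain ⟨v, q⟩ := v
  obtain ⟨w, s⟩ := w
  cases p <;> cases q <;> cases s <;> simp_all [Precedes] <;> omega⟩

theorem pairwise_precedes {l : List LBox} (h : l.IsChain Follows) : l.Pairwise Precedes :=
  List.isChain_iff_pairwise.1 (h.imp fun _ _ => Follows.precedes)

/-- The boxes of a list of labelled boxes. -/
abbrev boxes (l : List LBox) : List Box := l.map Prod.fst

theorem precedes_of_le {l : List LBox} (h : l.IsChain Follows)
    (ho : (boxes l).Pairwise fun x y => ¬ y ≤ x) {u v : LBox} (hu : u ∈ l) (hv : v ∈ l)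
    (huv : u.1 ≤ v.1) (hne : u.1 ≠ v.1) : Precedes u v := by
  have h1 := pairwise_precedes h
  rw [List.pairwise_map] at ho
  rw [List.pairwise_iff_getElem] at h1 ho
  obtain ⟨i, hi, rfl⟩ := List.getElem_of_mem hu
  obtain ⟨j, hj, rfl⟩ := List.getElem_of_mem hv
  rcases lt_trichotomy i j with hij | rfl | hij
  · exact h1 i j hi hj hij
  · exact absurd rfl hne
  · exact absurd huv (ho j i hj hi hij)

/-- A box with a box of the same letter to its left must be unprimed, and a box with one below it
must be primed; the middle box would be both. -/
theorem not_three {l : List LBox} (h : l.IsChain Follows)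
    (ho : (boxes l).Pairwise fun x y => ¬ y ≤ x) {x : Box} (h1 : x ∈ boxes l)
    (h2 : right x ∈ boxes l) (h3 : below (right x) ∈ boxes l) : False := by
  simp only [boxes, List.mem_map] at h1 h2 h3
  obtain ⟨u, hu, rfl⟩ := h1
  obtain ⟨v, hv, ev⟩ := h2
  obtain ⟨w, hw, ew⟩ := h3
  have huv := precedes_of_le h ho hu hv (by rw [ev]; simp [right, Prod.le_def])
    (by rw [ev]; simp [right, Prod.ext_iff])
  have hvw := precedes_of_le h ho hv hw
    (by rw [ev, ew]; simp [right, below, Prod.le_def]) (by rw [ev, ew]; simp [below, Prod.ext_iff])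
  simp only [Precedes, ev, ew, right, below] at huv hvw
  cases hq : v.2 <;> simp [hq] at huv hvw

/-- The reason for exception (ii): two successive unprimed inner letters stay in increasing columns,
unless the second stops at $(r+1,r+1)$ while the first waits at $(r,r)$. In that case the rows
increase instead, so the first letter can be primed consistently. -/
theorem pass_pair_cols {x₁ x₂ : Box} {l : List LBox} (h : LinExt (x₁ :: x₂ :: boxes l))
    (hl : l.IsChain Follows) (hc : x₁.2 < x₂.2) :
    (x₁.1 = x₁.2 ∧ (pass x₂ (boxes l)).2 = below (right x₁) ∧
      (pass x₁ (pass x₂ (boxes l)).1).2.1 < (pass x₂ (boxes l)).2.1) ∨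
    (¬ (x₁.1 = x₁.2 ∧ (pass x₂ (boxes l)).2 = below (right x₁)) ∧
      (pass x₁ (pass x₂ (boxes l)).1).2.2 < (pass x₂ (boxes l)).2.2) := by
  induction l generalizing x₁ x₂ with
  | nil =>
    have ho : ¬ x₁ ≤ x₂ ∨ x₂ = right x₁ ∨ x₂ = below x₁ := by
      by_cases hle : x₁ ≤ x₂
      · exact .inr (LinExt.next_of_le (A := []) h hle)
      · exact .inl hle
    refine .inr ⟨?_, by simpa [pass] using hc⟩
    rintro ⟨-, h2⟩
    simp only [pass, List.map_nil] at h2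
    subst h2
    rcases ho with ho | ho | ho
    · exact ho ⟨Nat.le_succ _, Nat.le_succ _⟩
    · simp [right, below] at ho
    · simp [right, below] at ho
  | cons y l ih =>
    have hh : LinExt (x₁ :: x₂ :: y.1 :: boxes l) := h
    have hP := hh.elemSwitch_pair
    have hoy : (boxes (y :: l)).Pairwise fun x y => ¬ y ≤ x := h.of_cons.of_cons.order
    have ho := hh.order
    simp only [List.pairwise_cons, List.mem_cons] at ho
    rcases elemSwitch_pair_cols hh hc with hc' | ⟨hd, rfl, hy⟩
    · have hge : x₁ ≤ (elemSwitch x₁ (elemSwitch x₂ y.1).1).2 := by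
        have := LinExt.elemSwitch (A := [x₁]) (C := boxes l) (x := x₂) (y := y.1) hh
        exact elemSwitch_snd_ge (A := []) this
      have hmv : (elemSwitch x₁ (elemSwitch x₂ y.1).1).2 = x₁ ∨
          ((elemSwitch x₁ (elemSwitch x₂ y.1).1).2 = (elemSwitch x₂ y.1).1 ∧
            Adj x₁ (elemSwitch x₂ y.1).1) := by
        by_cases k : Adj x₁ (elemSwitch x₂ y.1).1
        · right; exact ⟨by rw [elemSwitch, if_pos k], k⟩
        · left; rw [elemSwitch, if_neg k]
      have hI := ih hP hl.tail hc'
      rcases hmv with he | ⟨he, ha⟩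
      · simpa [pass, he] using hI
      · have hv2 := h.valid x₂ (by simp)
        have hv1 := h.valid x₁ (by simp)
        have hvy := h.valid y.1 (by simp)
        rcases hI with ⟨d1, d2, -⟩ | ⟨-, d2⟩
        -- Having moved, the first entry cannot start a new corner at a diagonal box: either it
        -- would have come from below the diagonal, or the outer boxes would contain the
        -- configuration excluded by `not_three`.
        · exfalso
          by_cases k : Adj x₂ y.1
          · rw [he] at d1 hge
            simp only [elemSwitch, k, if_true] at ha d1 hge
            have h12 := ho.1 x₂ (by simp)
            simp only [Adj, right, below, Prod.ext_iff, Prod.le_def] at ha h12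
            omega
          · rw [he] at d1 d2 hge
            simp only [elemSwitch, k, if_false] at ha d1 d2 hge
            have hw : below (right y.1) ∈ boxes l := by
              rcases pass_snd_mem x₂ (boxes l) with e | e
              · rw [d2] at e
                refine absurd ?_ (ho.2.1 y.1 (by simp))
                rw [← e]
                exact ⟨Nat.le_succ _, Nat.le_succ _⟩
              · rwa [d2] at e
            refine not_three hl hoy (x := y.1) (by simp) ?_ (List.mem_cons_of_mem _ hw)
            refine h.of_cons.of_cons.convex y.1 (by simp) _ (List.mem_cons_of_mem _ hw) _ ?_ ?_ ?_
            · simp [right, Prod.le_def]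
            · simp [right, below, Prod.le_def]
            · simp only [right]; omega
        -- Here the first entry has already left the diagonal for column $r+1$, so the second one,
        -- in a later column, cannot end at $(r+1,r+1)$.
        · refine .inr ⟨?_, by simpa [pass] using d2⟩
          rintro ⟨e1, e2⟩
          have hge2 : (elemSwitch x₁ (elemSwitch x₂ y.1).1).2 ≤
              (pass (elemSwitch x₁ (elemSwitch x₂ y.1).1).2
                (pass (elemSwitch x₂ y.1).2 (boxes l)).1).2 := by
            have := LinExt.pass (A := [(elemSwitch x₁ (elemSwitch x₂ y.1).1).2])
              (x := (elemSwitch x₂ y.1).2) (ys := boxes l) (C := []) (by simpa using hP)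
            exact pass_snd_ge (A := []) (C := [(pass (elemSwitch x₂ y.1).2 (boxes l)).2])
              (by simpa using this)
          simp only [pass, List.map_cons] at e2
          have hv := hP.valid (elemSwitch x₁ (elemSwitch x₂ y.1).1).2 (by simp)
          rw [e2] at d2
          rw [he] at d2 hge hge2 hv
          simp only [Adj, right, below, Prod.ext_iff, Prod.le_def] at *
          omega
    · have k1 : Adj (right x₁) y.1 := .inr (.inl hy)
      have k2 : Adj x₁ (right x₁) := .inl rfl
      -- After the corner switch the second entry stands at $(r+1,r+1)$ and stays there: an outer
      -- box to its right would force $(r,r+2)$ into the list, which no choice of prime allows.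
      have hno : pass y.1 (boxes l) = (boxes l, y.1) := by
        apply pass_eq_self
        intro w hw ha
        have hvw := h.valid w (by simp only [List.map_cons, List.mem_cons]; tauto)
        have hyw := ho.2.2.1 w hw
        have hw' : w = right y.1 := by
          rw [hy] at ha hyw ⊢
          simp only [Adj, right, below, Prod.ext_iff, Prod.le_def] at *
          omega
        have hv : right (right x₁) ∈ right x₁ :: y.1 :: boxes l := by
          refine h.of_cons.convex (right x₁) (by simp) w (by simp [hw]) _ ?_ ?_ ?_
          · simp [right, Prod.le_def]
          · rw [hw', hy]; simp [right, below, Prod.le_def]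
          · simp only [right]; omega
        simp only [List.mem_cons] at hv
        rcases hv with e | e | e
        · simp [right, Prod.ext_iff] at e
        · rw [hy] at e; simp [right, below, Prod.ext_iff] at e
        · simp only [boxes, List.mem_map] at e hw
          obtain ⟨v, hv, ev⟩ := e
          obtain ⟨w, hw, rfl⟩ := hw
          have hyv := (List.pairwise_cons.1 (pairwise_precedes hl)).1 v hv
          have hvw := precedes_of_le hl hoy (List.mem_cons_of_mem _ hv)
            (List.mem_cons_of_mem _ hw)
            (by rw [ev, hw', hy]; simp [right, below, Prod.le_def])
            (by rw [ev, hw', hy]; simp [right, below, Prod.ext_iff])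
          simp only [Precedes, ev, hw', hy, right, below] at hyv hvw
          cases hq : v.2 <;> simp [hq] at hyv hvw
      left
      have hrow := pass_pair_rows (x₁ := right x₁) (x₂ := y.1) (ys := boxes l)
        (by simpa [elemSwitch, k1, k2] using hP) (by rw [hy]; simp [right, below])
      refine ⟨hd, ?_, ?_⟩
      · rw [← hy]; simp [pass, elemSwitch, k1, hno]
      · simpa [pass, elemSwitch, k1, k2] using hrow

/-! ### The combinatorial state of the switching process -/

/-- The switching process when the boxes of `P` have been switched with `z` and those of `Q` have
not: the inner letters in `L` have not been moved, those in `S` have reached their final place. -/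
structure Inv (L P : List LBox) (z : LBox) (Q S : List LBox) : Prop where
  lin : LinExt (boxes (L ++ P ++ z :: Q ++ S))
  inner : (L ++ [z]).IsChain Follows
  outer : (P ++ Q).IsChain Follows
  last : ∀ u ∈ (P ++ Q).getLast?, u.2 = false
  diag : ∀ u ∈ P ++ Q, u.2 = true → u.1.1 ≠ u.1.2

theorem Inv.of_not_adj {L P Q S : List LBox} {z y : LBox} (h : Inv L P z (y :: Q) S)
    (hzy : ¬ Adj z.1 y.1) : Inv L (P ++ [y]) z Q S where
  lin := by
    have := LinExt.swap (A := boxes (L ++ P)) (C := boxes (Q ++ S)) (by simpa using h.lin) hzy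
    simpa using this
  inner := h.inner
  outer := by simpa using h.outer
  last := by simpa using h.last
  diag := by simpa using h.diag

theorem Inv.adj_cases {L P Q S : List LBox} {z y : LBox} (h : Inv L P z Q S) (hy : y ∈ Q)
    (hzy : Adj z.1 y.1) : y.1 = right z.1 ∨ y.1 = below z.1 := by
  have ho := h.lin.order
  simp only [boxes, List.map_append, List.map_cons, List.pairwise_append, List.pairwise_cons] at ho
  have := ho.1.2.1.1 y.1 (List.mem_map_of_mem hy)
  simp only [Adj, right, below, Prod.ext_iff, Prod.le_def] at *
  omega

theorem Follows.mono_right {u v w : LBox} (h : Follows u v) (hvw : v.1 ≤ w.1) (he : v.2 = w.2) :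
    Follows u w := by
  simp only [Follows, Prod.le_def] at *
  rw [← he]
  exact ⟨fun hu => (h.1 hu).trans_le hvw.1, fun hu => ⟨(h.2 hu).1, (h.2 hu).2.trans_le hvw.2⟩⟩

theorem Follows.mono_left {u v w : LBox} (h : Follows v w) (huv : u.1 ≤ v.1) (he : u.2 = v.2) :
    Follows u w := by
  simp only [Follows, Prod.le_def] at *
  rw [he]
  exact ⟨fun hu => huv.1.trans_lt (h.1 hu), fun hu => ⟨(h.2 hu).1, huv.2.trans_lt (h.2 hu).2⟩⟩

theorem Inv.inner_of_le {L P Q S : List LBox} {z : LBox} {x : Box} (h : Inv L P z Q S)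
    (hx : z.1 ≤ x) : (L ++ [(x, z.2)]).IsChain Follows := by
  have := h.inner
  rw [List.isChain_append] at this ⊢
  refine ⟨this.1, by simp, fun u hu v hv => ?_⟩
  simp only [List.head?_cons, Option.mem_def, Option.some.injEq] at hv
  subst hv
  exact (this.2.2 u hu z (by simp)).mono_right hx rfl

theorem Inv.le_of_adj {L P Q S : List LBox} {z y : LBox} (h : Inv L P z Q S) (hy : y ∈ Q)
    (hzy : Adj z.1 y.1) : z.1 ≤ y.1 := by
  rcases h.adj_cases hy hzy with e | e <;> rw [e] <;> simp [right, below, Prod.le_def]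

/-- The outer letter moves from `y` to `z`, up or to the left. Only its relation to the preceding
outer letter is in question, and convexity forces it. -/
theorem Inv.of_adj {L P Q S : List LBox} {z y : LBox} (h : Inv L P z (y :: Q) S)
    (hzy : Adj z.1 y.1) (hd : ¬ (y.2 = true ∧ z.1.1 = z.1.2)) :
    Inv L (P ++ [(z.1, y.2)]) (y.1, z.2) Q S where
  lin := by simpa using h.lin
  inner := h.inner_of_le (h.le_of_adj (by simp) hzy)
  outer := by
    have hyz := h.adj_cases (by simp) hzy
    have hle := h.le_of_adj (by simp) hzy
    have ho := h.outer
    rw [List.append_assoc, List.singleton_append]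
    rw [List.isChain_append, List.isChain_cons] at ho ⊢
    refine ⟨ho.1, ⟨fun v hv => (ho.2.1.1 v hv).mono_left hle rfl, ho.2.1.2⟩, fun u hu v hv => ?_⟩
    simp only [List.head?_cons, Option.mem_def, Option.some.injEq] at hv
    subst hv
    have huy := ho.2.2 u hu y (by simp)
    obtain ⟨P', rfl⟩ : ∃ P', P = P' ++ [u] := by
      rw [Option.mem_def, List.getLast?_eq_some_iff] at hu
      exact hu
    have hlin : LinExt (boxes (L ++ P') ++ u.1 :: [z.1] ++ y.1 :: boxes (Q ++ S)) := by
      simpa using h.lin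
    have hb := fun b => hlin.mem_between (b := b)
    have hn := fun hle => LinExt.next_of_le (A := boxes (L ++ P')) (x := u.1) (y := z.1)
      (C := y.1 :: boxes (Q ++ S)) (by simpa using h.lin) hle
    have hvu := hlin.valid u.1 (by simp)
    have hvz := hlin.valid z.1 (by simp)
    have hvy := hlin.valid y.1 (by simp)
    have hdu := h.diag u (by simp)
    have hord := hlin.order
    simp only [List.pairwise_append, List.pairwise_cons, List.mem_cons, List.append_assoc,
      List.cons_append] at hord
    have o1 := hord.2.1.1 z.1 (by simp)
    -- If the order failed, `u` would be the upper neighbour of `z` with `y` to the right of `z`, or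
    -- the left neighbour with `y` below. The fourth corner of the square would then be a forbidden
    -- intermediate box. If that corner lies below the diagonal, `u` is a primed diagonal box, which
    -- `diag` excludes.
    have b1 := hb (z.1.1 - 1, z.1.2 + 1)
    have b2 := hb (z.1.1 + 1, z.1.2 - 1)
    clear hord hb hlin ho
    obtain ⟨⟨r, c⟩, p⟩ := z
    obtain ⟨⟨s, d⟩, q⟩ := y
    obtain ⟨⟨r', c'⟩, p'⟩ := u
    simp only [Follows, right, below, Prod.le_def, Prod.ext_iff, List.mem_singleton] at *
    cases p' <;> simp at * <;> first | omega | exact ⟨huy.1, by omega⟩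
  last := by
    have := h.last
    cases Q <;> simp_all
  diag := by
    intro u hu hp
    simp only [List.append_assoc, List.mem_append, List.mem_cons, List.not_mem_nil, or_false] at hu
    rcases hu with hu | rfl | hu
    · exact h.diag u (by simp [hu]) hp
    · exact fun e => hd ⟨hp, e⟩
    · exact h.diag u (by simp [hu]) hp

/-- If `z` is on the diagonal and `y` to its right is primed, then the next box is below `y`. -/
theorem Inv.next_of_diag {L P Q S : List LBox} {z y : LBox} (h : Inv L P z (y :: Q) S)
    (hzy : Adj z.1 y.1) (hy : y.2 = true) (hz : z.1.1 = z.1.2) :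
    y.1 = right z.1 ∧ ∃ Q', Q = (below (right z.1), false) :: Q' := by
  have hvy := h.lin.valid y.1 (by simp)
  have e : y.1 = right z.1 := by
    rcases h.adj_cases (by simp) hzy with e | e
    · exact e
    · rw [e] at hvy; simp only [below] at hvy; omega
  refine ⟨e, ?_⟩
  match Q, h with
  | [], h =>
    have := h.last y (by simp)
    simp [hy] at this
  | v :: Q', h =>
    have hvv := h.lin.valid v.1 (by simp)
    have ho := h.outer
    rw [List.isChain_append, List.isChain_cons_cons] at ho
    have hr := ho.2.1.1.1 hy
    have hv : v.1 = below y.1 := by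
      rcases LinExt.next_of_le (A := boxes (L ++ P ++ [z])) (C := boxes (Q' ++ S)) (x := y.1)
        (y := v.1) (by simpa using h.lin)
        (by rw [e] at hr ⊢; simp only [right, Prod.le_def] at *; omega) with e' | e'
      · rw [e'] at hr; simp [right] at hr
      · exact e'
    have hp : v.2 = false := by
      have := h.diag v (by simp)
      rw [hv, e] at this
      simpa [right, below, hz] using this
    exact ⟨Q', by rw [← e, ← hv, ← hp]⟩

/-- An outer letter that arrives on the diagonal loses its prime. This respects the order because
the next outer box is the unprimed $(r+1,r+1)$, in a later column. It is the first half of exception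
(i). -/
theorem Inv.of_adj_diag {L P Q S : List LBox} {z y : LBox} (h : Inv L P z (y :: Q) S)
    (hzy : Adj z.1 y.1) (hy : y.2 = true) (hz : z.1.1 = z.1.2) :
    Inv L (P ++ [(z.1, false)]) (y.1, z.2) Q S := by
  obtain ⟨e, Q', rfl⟩ := h.next_of_diag hzy hy hz
  refine ⟨by simpa using h.lin, h.inner_of_le (h.le_of_adj (by simp) hzy), ?_, ?_, ?_⟩
  · have ho := h.outer
    rw [List.append_assoc, List.singleton_append]
    rw [List.isChain_append, List.isChain_cons_cons] at ho ⊢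
    refine ⟨ho.1, ⟨by simp [Follows, right, below], ho.2.1.2⟩, fun u hu v hv => ?_⟩
    simp only [List.head?_cons, Option.mem_def, Option.some.injEq] at hv
    subst hv
    have := ho.2.2 u hu y (by simp)
    obtain ⟨y, q⟩ := y
    simp only at hy e
    subst hy e
    simp only [Follows, right] at this ⊢
    cases hq : u.2 <;> simp_all
  · have := h.last
    simp_all
  · intro u hu hp
    simp only [List.append_assoc, List.mem_append, List.mem_cons, List.not_mem_nil, or_false] at hu
    rcases hu with hu | rfl | hu
    · exact h.diag u (by simp [hu]) hp
    · simp at hp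
    · exact h.diag u (by simp only [List.mem_append, List.mem_cons]; tauto) hp

/-! ### The exceptional letter on the diagonal -/

/-- A run of primed boxes descends strictly, and its successor is still lower. This serves to
exclude a primed waiting letter in `Inv.exceptional`. -/
theorem exists_unprimed_below {u z : LBox} {M : List LBox} (h : (u :: M ++ [z]).IsChain Follows)
    (hu : u.2 = true) : u.1.1 < z.1.1 ∨ ∃ w ∈ M, w.2 = false ∧ u.1.1 < w.1.1 := by
  induction M generalizing u with
  | nil =>
    simp only [List.cons_append, List.nil_append, List.isChain_cons_cons] at h
    exact .inl (h.1.1 hu)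
  | cons w M ih =>
    simp only [List.cons_append, List.isChain_cons_cons] at h
    have huw := h.1.1 hu
    cases hw : w.2
    · exact .inr ⟨w, by simp, hw, huw⟩
    · rcases ih (by simpa using h.2) hw with h' | ⟨v, hv, h1, h2⟩
      · exact .inl (huw.trans h')
      · exact .inr ⟨v, by simp [hv], h1, huw.trans h2⟩

theorem Inv.valid_inner {L P Q S : List LBox} {z u : LBox} (h : Inv L P z Q S) (hu : u ∈ L) :
    u.1.1 ≤ u.1.2 :=
  h.lin.valid _ (List.mem_map_of_mem (by simp [hu]))

/-- If an inner box `(r, r)` waits while the current box is `(r, r + 1)`, then both are unprimed,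
`(r, r)` is the next box to be moved, and the others in `L` are primed. -/
theorem Inv.exceptional {L P Q S : List LBox} {z u : LBox} (h : Inv L P z Q S) (hu : u ∈ L)
    (hd : u.1.1 = u.1.2) (hz : z.1 = right u.1) :
    z.2 = false ∧ ∃ L', L = L' ++ [(u.1, false)] ∧ ∀ v ∈ L'.getLast?, v.2 = true := by
  obtain ⟨A, B, rfl⟩ := List.append_of_mem hu
  have hin := h.inner
  rw [List.append_assoc, List.cons_append, List.isChain_append] at hin
  have hpw := List.pairwise_cons.1 (pairwise_precedes hin.2.1)
  have huz := hpw.1 z (by simp)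
  have hz2 : z.2 = false := by
    cases hz2 : z.2
    · rfl
    · have := (huz.1 hz2).2
      simp [hz, right] at this
  have hu2 : u.2 = false := by
    cases hu2 : u.2
    · rfl
    · rcases exists_unprimed_below hin.2.1 hu2 with h' | ⟨w, hw, h1, h2⟩
      · simp [hz, right] at h'
      · have hwz := (List.pairwise_append.1 hpw.2).2.2 w hw z (by simp)
        have := (hwz.2 h1).2
        have hv := h.valid_inner (u := w) (by simp [hw])
        simp only [hz, right] at this
        omega
  have hB : B = [] := by
    match B with
    | [] => rfl
    | w :: B =>
      have h1 := hpw.1 w (by simp)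
      have h2 := (List.pairwise_cons.1 hpw.2).1 z (by simp)
      have := (h1.2 hu2)
      have := (h2.2 this.1).2
      simp only [hz, right] at this
      omega
  subst hB
  refine ⟨hz2, A, by rw [← hu2], fun v hv => ?_⟩
  obtain ⟨A', rfl⟩ : ∃ A', A = A' ++ [v] := List.getLast?_eq_some_iff.1 hv
  have hvu := hin.2.2 v (by simp) u (by simp)
  cases hv2 : v.2
  · exfalso
    have hvv := h.valid_inner (u := v) (by simp)
    have hc := (hvu.2 hv2).2
    have := LinExt.next_of_le (A := boxes A') (x := v.1) (y := u.1) (C := boxes (P ++ z :: Q ++ S))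
      (by simpa using h.lin) (by simp only [Prod.le_def]; omega)
    simp only [right, below, Prod.ext_iff] at this
    omega
  · rfl

/-- Once the current box has reached `(r + 1, r + 1)` and `(r, r)` waits, it does not move. -/
theorem Inv.not_adj_of_diag {L P Q S : List LBox} {z u y : LBox} (h : Inv L P z Q S) (hu : u ∈ L)
    (hd : u.1.1 = u.1.2) (hz : z.1 = below (right u.1)) (hy : y ∈ Q) : ¬ Adj z.1 y.1 := by
  intro hzy
  have hvy := h.lin.valid y.1 (List.mem_map_of_mem (by simp [hy]))
  have hy' : y.1 = right z.1 := by
    rcases h.adj_cases hy hzy with e | e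
    · exact e
    · rw [e, hz] at hvy; simp only [below, right] at hvy; omega
  have hord := h.lin.order
  simp only [boxes, List.map_append, List.map_cons, List.pairwise_append, List.pairwise_cons] at hord
  have hS : ∀ x ∈ S, ¬ x.1 ≤ y.1 := fun x hx =>
    hord.2.2 y.1 (by simp only [List.mem_append, List.mem_cons]; right; right; exact List.mem_map_of_mem hy)
      x.1 (List.mem_map_of_mem hx)
  have hPQ : (boxes (P ++ Q)).Pairwise fun x y => ¬ y ≤ x := by
    refine h.lin.order.sublist (List.Sublist.map _ ?_)
    have h1 : (P ++ Q).Sublist (P ++ z :: Q) := (List.sublist_cons_self z Q).append_left P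
    have h2 : (P ++ z :: Q).Sublist (L ++ (P ++ z :: Q) ++ S) :=
      (List.sublist_append_right L _).trans (List.sublist_append_left _ S)
    simpa using h1.trans h2
  have hLc : ∀ x ∈ L, x.1 = right u.1 ∨ x.1 = right (right u.1) → False := by
    intro x hx hxe
    have hin := h.inner
    have hor : (boxes (L ++ [z])).Pairwise fun x y => ¬ y ≤ x := by
      refine h.lin.order.sublist (List.Sublist.map _ ?_)
      simp
    rcases hxe with hxe | hxe
    · refine not_three hin hor (x := u.1) ?_ ?_ ?_
      · exact List.mem_map_of_mem (by simp [hu])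
      · rw [← hxe]; exact List.mem_map_of_mem (by simp [hx])
      · rw [← hz]; exact List.mem_map_of_mem (by simp)
    · have h1 := precedes_of_le hin hor (u := u) (v := x) (by simp [hu]) (by simp [hx])
        (by rw [hxe]; simp [right, Prod.le_def]; omega)
        (by rw [hxe]; simp [right, Prod.ext_iff]; omega)
      have h2 := (List.pairwise_append.1 (pairwise_precedes hin)).2.2 x hx z (by simp)
      simp only [Precedes, hxe, hz, right, below] at h1 h2
      cases hq : x.2 <;> simp [hq] at h1 h2
  have hmem : ∀ w : Box, u.1 ≤ w → w ≤ y.1 → w.1 ≤ w.2 →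
      (w = right u.1 ∨ w = right (right u.1)) → w ∈ boxes (P ++ Q) := by
    intro w h1 h2 h3 h4
    -- The boxes $(r,r+1)$ and $(r,r+2)$ are filled by convexity. They are neither waiting nor
    -- settled inner boxes, so they are outer, and together with `y` they contradict `not_three`.
    have := h.lin.convex u.1 (List.mem_map_of_mem (by simp [hu])) y.1
      (List.mem_map_of_mem (by simp [hy])) w h1 h2 h3
    simp only [boxes, List.mem_map, List.mem_append, List.mem_cons] at this ⊢
    obtain ⟨v, hv, rfl⟩ := this
    rcases hv with ((hv | hv) | rfl | hv) | hv
    · exact (hLc v hv h4).elim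
    · exact ⟨v, .inl hv, rfl⟩
    · simp only [hz, right, below, Prod.ext_iff] at h4; omega
    · exact ⟨v, .inr hv, rfl⟩
    · exact absurd h2 (hS v hv)
  have m1 := hmem (right u.1) (by simp [right, Prod.le_def])
    (by rw [hy', hz]; simp [right, below, Prod.le_def]) (by simp only [right]; omega) (.inl rfl)
  have m2 := hmem (right (right u.1)) (by simp [right, Prod.le_def]; omega)
    (by rw [hy', hz]; simp [right, below, Prod.le_def]) (by simp only [right]; omega) (.inr rfl)
  refine not_three h.outer hPQ m1 m2 ?_
  have : below (right (right u.1)) = y.1 := by rw [hy', hz]; rfl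
  rw [this]
  exact List.mem_map_of_mem (by simp [hy])

/-- The inner letters with that of the diagonal box `(r, r)` primed, if `x = (r + 1, r + 1)`. -/
def primeDiag (x : Box) (L : List LBox) : List LBox :=
  L.map fun u => if u.1.1 = u.1.2 ∧ x = below (right u.1) then (u.1, true) else u

theorem boxes_primeDiag (x : Box) (L : List LBox) : boxes (primeDiag x L) = boxes L := by
  simp only [boxes, primeDiag, List.map_map]
  refine List.map_congr_left fun u _ => ?_
  simp only [Function.comp_apply]
  split_ifs <;> rfl

theorem primeDiag_eq_self {x : Box} {L : List LBox}
    (h : ∀ u ∈ L, ¬ (u.1.1 = u.1.2 ∧ x = below (right u.1))) : primeDiag x L = L := by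
  rw [primeDiag, List.map_congr_left (g := id), List.map_id]
  intro u hu
  rw [if_neg (h u hu), id]

/-- A current letter that still moves is not at $(r+1,r+1)$ with $(r,r)$ waiting, so no prime has
been added yet. -/
theorem Inv.primeDiag_of_adj {L P Q S : List LBox} {z y : LBox}
    (h : Inv (primeDiag z.1 L) P z Q S) (hy : y ∈ Q) (hzy : Adj z.1 y.1) :
    primeDiag z.1 L = L := by
  refine ShiftedBK.primeDiag_eq_self fun u hu hd => ?_
  have : u.1 ∈ boxes (primeDiag z.1 L) := by
    rw [boxes_primeDiag]; exact List.mem_map_of_mem hu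
  simp only [boxes, List.mem_map] at this
  obtain ⟨v, hv, e⟩ := this
  rw [← e] at hd
  exact h.not_adj_of_diag hv hd.1 hd.2 hy hzy

/-- Before any switch the inner boxes are convex, so $(r,r)$ and $(r+1,r+1)$ would bring in
$(r,r+1)$, against `not_three`. Hence a pass starts without an added prime. -/
theorem Inv.primeDiag_start {L Q S : List LBox} {z : LBox} (h : Inv L [] z Q S) :
    primeDiag z.1 L = L := by
  refine ShiftedBK.primeDiag_eq_self fun u hu ⟨hd, hz⟩ => ?_
  have hlin : LinExt (boxes (L ++ [z])) :=
    LinExt.infix (A := []) (C := boxes (Q ++ S)) (by simpa using h.lin)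
  refine not_three h.inner hlin.order (x := u.1) (List.mem_map_of_mem (by simp [hu])) ?_ ?_
  · refine hlin.convex u.1 (List.mem_map_of_mem (by simp [hu])) z.1
      (List.mem_map_of_mem (by simp)) _ ?_ ?_ ?_
    · simp [right, Prod.le_def]
    · rw [hz]; simp [right, below, Prod.le_def]
    · simp only [right]; omega
  · rw [← hz]; exact List.mem_map_of_mem (by simp)

/-- The state after a switch in which the waiting letter on the diagonal is primed. -/
theorem Inv.of_adj_exceptional {L P Q S : List LBox} {z y : LBox} {x : Box}
    (h : Inv (L ++ [(x, false)]) P z (y :: Q) S) (hd : x.1 = x.2) (hz : z.1 = right x)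
    (hy : y.1 = below z.1) (hL : ∀ v ∈ L.getLast?, v.2 = true) :
    Inv (L ++ [(x, true)]) (P ++ [(z.1, y.2)]) (y.1, z.2) Q S := by
  have h' := h.of_adj (.inr (.inl hy)) (by rw [hz]; simp only [right]; omega)
  refine ⟨by simpa using h'.lin, ?_, h'.outer, h'.last, h'.diag⟩
  have hin := h'.inner
  rw [List.append_assoc, List.singleton_append, List.isChain_append] at hin ⊢
  refine ⟨hin.1, by simp [Follows, hy, hz, right, below], fun v hv w hw => ?_⟩
  simp only [List.head?_cons, Option.mem_def, Option.some.injEq] at hw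
  subst hw
  have hv2 := hL v hv
  have := hin.2.2 v hv (x, false) (by simp)
  simp_all [Follows]

/-! ### Fillings represented by lists of labelled boxes -/

/-- `as` lists the **a**-boxes of `T` and `bs` its **b**-boxes. -/
structure Rep (a b : ℕ+) (T : Filling) (as bs : List LBox) : Prop where
  inner : ∀ u ∈ as, T u.1 = some ⟨a, u.2⟩
  outer : ∀ u ∈ bs, T u.1 = some ⟨b, u.2⟩
  rest : ∀ x, x ∉ boxes as → x ∉ boxes bs → ¬ IsIn T a x ∧ ¬ IsIn T b x

section
variable {a b : ℕ+} {T : Filling}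

theorem Rep.isIn_inner {as bs : List LBox} (hab : a ≠ b) (h : Rep a b T as bs) (x : Box) :
    IsIn T a x ↔ x ∈ boxes as := by
  constructor
  · rintro ⟨l, hl, rfl⟩
    by_contra hx
    by_cases hx' : x ∈ boxes bs
    · obtain ⟨u, hu, rfl⟩ := List.mem_map.1 hx'
      rw [h.outer u hu] at hl
      simp only [Option.some.injEq] at hl
      exact hab (by rw [← hl])
    · exact (h.rest x hx hx').1 ⟨l, hl, rfl⟩
  · intro hx
    obtain ⟨u, hu, rfl⟩ := List.mem_map.1 hx
    exact ⟨_, h.inner u hu, rfl⟩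

theorem Rep.symm {as bs : List LBox} (h : Rep a b T as bs) : Rep b a T bs as :=
  ⟨h.outer, h.inner, fun x h1 h2 => (h.rest x h2 h1).symm⟩

theorem Rep.isIn_outer {as bs : List LBox} (hab : a ≠ b) (h : Rep a b T as bs) (x : Box) :
    IsIn T b x ↔ x ∈ boxes bs :=
  h.symm.isIn_inner hab.symm x

theorem isIn_of_eq {a : ℕ+} {x : Box} {p : Bool} (h : T x = some ⟨a, p⟩) : IsIn T a x := ⟨_, h, rfl⟩

theorem Rep.exchange {A B C D : List LBox} {x y : Box} {p q : Bool}
    (h : Rep a b T (A ++ (x, p) :: B) (C ++ (y, q) :: D))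
    (hx : ∀ u ∈ A ++ B ++ C ++ D, u.1 ≠ x) (hy : ∀ u ∈ A ++ B ++ C ++ D, u.1 ≠ y) :
    Rep a b (exchange T x y) (A ++ (y, p) :: B) (C ++ (x, q) :: D) := by
  have hne : ∀ u ∈ A ++ B ++ C ++ D, Equiv.swap x y u.1 = u.1 := fun u hu =>
    Equiv.swap_apply_of_ne_of_ne (hx u hu) (hy u hu)
  refine ⟨fun u hu => ?_, fun u hu => ?_, fun w h1 h2 => ?_⟩
  · simp only [List.mem_append, List.mem_cons] at hu
    simp only [ShiftedBK.exchange, Function.comp_apply]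
    rcases hu with hu | rfl | hu
    · rw [hne u (by simp [hu])]; exact h.inner u (by simp [hu])
    · rw [Equiv.swap_apply_right]; exact h.inner (x, p) (by simp)
    · rw [hne u (by simp [hu])]; exact h.inner u (by simp [hu])
  · simp only [List.mem_append, List.mem_cons] at hu
    simp only [ShiftedBK.exchange, Function.comp_apply]
    rcases hu with hu | rfl | hu
    · rw [hne u (by simp [hu])]; exact h.outer u (by simp [hu])
    · rw [Equiv.swap_apply_left]; exact h.outer (y, q) (by simp)
    · rw [hne u (by simp [hu])]; exact h.outer u (by simp [hu])
  · simp only [boxes, List.map_append, List.map_cons, List.mem_append, List.mem_cons, not_or] at h1 h2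
    have := h.rest w
      (by simp only [boxes, List.map_append, List.map_cons, List.mem_append, List.mem_cons]; tauto)
      (by simp only [boxes, List.map_append, List.map_cons, List.mem_append, List.mem_cons]; tauto)
    simpa [IsIn, ShiftedBK.exchange, Equiv.swap_apply_of_ne_of_ne h2.2.1 h1.2.1] using this

theorem Rep.update_inner {A B C : List LBox} {x : Box} {p : Bool} (p' : Bool)
    (h : Rep a b T (A ++ (x, p) :: B) C) (hx : ∀ u ∈ A ++ B ++ C, u.1 ≠ x) :
    Rep a b (Function.update T x (some ⟨a, p'⟩)) (A ++ (x, p') :: B) C := by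
  refine ⟨fun u hu => ?_, fun u hu => ?_, fun w h1 h2 => ?_⟩
  · simp only [List.mem_append, List.mem_cons] at hu
    rcases hu with hu | rfl | hu
    · rw [Function.update_of_ne (hx u (by simp [hu]))]; exact h.inner u (by simp [hu])
    · simp
    · rw [Function.update_of_ne (hx u (by simp [hu]))]; exact h.inner u (by simp [hu])
  · rw [Function.update_of_ne (hx u (by simp [hu]))]; exact h.outer u hu
  · have hwx : w ≠ x := by rintro rfl; simp at h1
    have := h.rest w (by simpa using h1) h2
    simpa [IsIn, Function.update_of_ne hwx] using this

theorem Rep.update_outer {A B C : List LBox} {x : Box} {p : Bool} (p' : Bool)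
    (h : Rep a b T C (A ++ (x, p) :: B)) (hx : ∀ u ∈ A ++ B ++ C, u.1 ≠ x) :
    Rep a b (Function.update T x (some ⟨b, p'⟩)) C (A ++ (x, p') :: B) :=
  (h.symm.update_inner p' hx).symm

/-! ### The order of the switches -/

/-- The orbits of `T` and `T'` under the switching process merge. -/
def Joins (a b : ℕ+) (T T' : Filling) : Prop :=
  ∃ m n, (switchStep a b)^[m] T = (switchStep a b)^[n] T'

theorem Joins.refl (T : Filling) : Joins a b T T := ⟨0, 0, rfl⟩

theorem Joins.trans {T T' T'' : Filling} (h : Joins a b T T') (h' : Joins a b T' T'') :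
    Joins a b T T'' := by
  obtain ⟨m, n, e⟩ := h
  obtain ⟨m', n', e'⟩ := h'
  refine ⟨m' + m, n + n', ?_⟩
  rw [Function.iterate_add_apply, e, ← Function.iterate_add_apply, Nat.add_comm m' n,
    Function.iterate_add_apply, e', ← Function.iterate_add_apply]

theorem Joins.of_step_eq {T T' : Filling} (h : switchStep a b T = switchStep a b T') :
    Joins a b T T' := ⟨1, 1, h⟩

theorem Joins.step (T : Filling) : Joins a b T (switchStep a b T) := ⟨1, 0, rfl⟩

section
variable {L P Q S : List LBox} {z : LBox}

theorem Inv.order_S (h : Inv L P z Q S) {u v : LBox} (hu : u ∈ S) (hv : v ∈ L ++ P ++ z :: Q) :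
    ¬ u.1 ≤ v.1 := by
  have ho := h.lin.order
  rw [boxes, List.map_append, List.pairwise_append] at ho
  exact ho.2.2 v.1 (List.mem_map_of_mem hv) u.1 (List.mem_map_of_mem hu)

theorem Inv.order_z (h : Inv L P z Q S) {u : LBox} (hu : u ∈ L ++ P) : ¬ z.1 ≤ u.1 := by
  have ho := h.lin.order
  rw [boxes, List.append_assoc, List.map_append, List.pairwise_append] at ho
  exact ho.2.2 u.1 (List.mem_map_of_mem hu) z.1 (by simp)

/-- The settled letters come after all outer boxes, so only `z` and the letters in `L` can be
switchable. Of these `z` is the last in the standard order, and the rule (rightmost unprimed, else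
bottommost primed) selects exactly the last one. -/
theorem Inv.isNext_iff (hab : a ≠ b) (h : Inv L P z Q S) (hr : Rep a b T (L ++ z :: S) (P ++ Q))
    {y : LBox} (hy : y ∈ Q) (hzy : Adj z.1 y.1) (x : Box) : IsNext T a b x ↔ x = z.1 := by
  have hcz : CanSwitch T a b z.1 := by
    refine ⟨(hr.isIn_inner hab _).2 (by simp), ?_⟩
    have hyb : IsIn T b y.1 := (hr.isIn_outer hab _).2 (List.mem_map_of_mem (by simp [hy]))
    rcases h.adj_cases hy hzy with e | e
    · exact .inl (e ▸ hyb)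
    · exact .inr (e ▸ hyb)
  have hcs : ∀ x, CanSwitch T a b x → x = z.1 ∨ ∃ u ∈ L, u.1 = x := by
    rintro x ⟨h1, h2⟩
    rw [hr.isIn_inner hab] at h1
    rw [hr.isIn_outer hab, hr.isIn_outer hab] at h2
    simp only [boxes, List.mem_map, List.mem_append, List.mem_cons] at h1
    obtain ⟨u, hu | rfl | hu, rfl⟩ := h1
    · exact .inr ⟨u, hu, rfl⟩
    · exact .inl rfl
    · exfalso
      rcases h2 with h2 | h2 <;> obtain ⟨v, hv, e⟩ := List.mem_map.1 h2
      · refine h.order_S hu (v := v) (by simp only [List.mem_append, List.mem_cons] at *; tauto) ?_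
        rw [e]; simp [right, Prod.le_def]
      · refine h.order_S hu (v := v) (by simp only [List.mem_append, List.mem_cons] at *; tauto) ?_
        rw [e]; simp [below, Prod.le_def]
  have hT : ∀ u ∈ L, T u.1 = some ⟨a, u.2⟩ := fun u hu => hr.inner u (by simp [hu])
  have hTz : T z.1 = some ⟨a, z.2⟩ := hr.inner z (by simp)
  have hpre : ∀ u ∈ L, Precedes u z := fun u hu =>
    (List.pairwise_append.1 (pairwise_precedes h.inner)).2.2 u hu z (by simp)
  constructor
  · rintro ⟨h1, h2⟩
    rcases hcs x h1 with rfl | ⟨u, hu, rfl⟩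
    · rfl
    · exfalso
      have hp := hpre u hu
      rcases h2 with ⟨h2, h3⟩ | ⟨h2, h3⟩
      · rw [hT u hu] at h2
        simp only [Option.some.injEq, Letter.mk.injEq, true_and] at h2
        have := h3 z.1 hcz (by rw [hTz, (hp.2 h2).1])
        have := (hp.2 h2).2
        omega
      · have hz2 : z.2 = true := by
          cases hz2 : z.2
          · exact absurd (by rw [hTz, hz2]) (h2 z.1 hcz)
          · rfl
        have := (hp.1 hz2).2
        have := h3 z.1 hcz
        omega
  · rintro rfl
    refine ⟨hcz, ?_⟩
    cases hz2 : z.2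
    · refine .inl ⟨by rw [hTz, hz2], fun x hx he => ?_⟩
      rcases hcs x hx with rfl | ⟨u, hu, rfl⟩
      · exact le_rfl
      · rw [hT u hu] at he
        simp only [Option.some.injEq, Letter.mk.injEq, true_and] at he
        exact ((hpre u hu).2 he).2.le
    · refine .inr ⟨fun x hx he => ?_, fun x hx => ?_⟩
      · rcases hcs x hx with rfl | ⟨u, hu, rfl⟩
        · rw [hTz, hz2] at he; simp at he
        · rw [hT u hu, ((hpre u hu).1 hz2).1] at he; simp at he
      · rcases hcs x hx with rfl | ⟨u, hu, rfl⟩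
        · exact le_rfl
        · exact ((hpre u hu).1 hz2).2.le

theorem Inv.switchStep_eq (hab : a ≠ b) (h : Inv L P z Q S)
    (hr : Rep a b T (L ++ z :: S) (P ++ Q)) {y : LBox} (hy : y ∈ Q) (hzy : Adj z.1 y.1) :
    switchStep a b T = switchAt T a b z.1 := by
  have hx := h.isNext_iff hab hr hy hzy
  have he : ∃ x, IsNext T a b x := ⟨z.1, (hx _).2 rfl⟩
  rw [switchStep, dif_pos he, (hx _).1 he.choose_spec]

theorem Inv.ne_z (h : Inv L P z Q S) {u : LBox} (hu : u ∈ L ++ P ++ Q ++ S) : u.1 ≠ z.1 := by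
  have hn := h.lin.nodup
  have e : L ++ P ++ z :: Q ++ S = (L ++ P) ++ z :: (Q ++ S) := by simp
  rw [e, boxes, List.map_append, List.map_cons, List.nodup_middle, List.nodup_cons,
    ← List.map_append] at hn
  rintro e'
  exact hn.1 (e' ▸ List.mem_map_of_mem (by simpa using hu))

theorem Inv.ne_y {y : LBox} (h : Inv L P z (y :: Q) S) {u : LBox} (hu : u ∈ L ++ P ++ z :: Q ++ S) :
    u.1 ≠ y.1 := by
  have hn := h.lin.nodup
  have e : L ++ P ++ z :: y :: Q ++ S = (L ++ P ++ [z]) ++ y :: (Q ++ S) := by simp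
  rw [e, boxes, List.map_append, List.map_cons, List.nodup_middle, List.nodup_cons,
    ← List.map_append] at hn
  rintro e'
  exact hn.1 (e' ▸ List.mem_map_of_mem (by simpa using hu))

end

end

/-! ### One elementary switch of the process -/

section
variable {a b : ℕ+} {T : Filling} {L P Q S : List LBox} {z y : LBox}

theorem Inv.rep_exchange (h : Inv L P z (y :: Q) S)
    (hr : Rep a b T (L ++ z :: S) (P ++ y :: Q)) :
    Rep a b (exchange T z.1 y.1) (L ++ (y.1, z.2) :: S) (P ++ (z.1, y.2) :: Q) := by
  refine Rep.exchange (p := z.2) (q := y.2) hr (fun u hu => h.ne_z ?_) (fun u hu => h.ne_y ?_) <;>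
  · simp only [List.mem_append, List.mem_cons] at hu ⊢
    tauto

/-- An elementary switch that is a step of the process. -/
theorem Inv.switchAt_eq_exchange (hab : a ≠ b) (h : Inv L P z (y :: Q) S)
    (hr : Rep a b T (L ++ z :: S) (P ++ y :: Q)) (hzy : Adj z.1 y.1)
    (h3 : ¬ (y.2 = true ∧ z.1.1 = z.1.2))
    (h4 : ∀ u ∈ L, ¬ (u.1.1 = u.1.2 ∧ y.1 = below (right u.1))) :
    switchAt T a b z.1 = exchange T z.1 y.1 := by
  have hTy : T y.1 = some ⟨b, y.2⟩ := hr.outer y (by simp)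
  have hyb : IsIn T b y.1 := isIn_of_eq hTy
  have hpy := (List.pairwise_cons.1 (List.pairwise_append.1 (pairwise_precedes h.outer)).2.1).1
  have hQ : ∀ x, z.1 ≤ x → x ≠ y.1 → IsIn T b x → ∃ v ∈ Q, v.1 = x := by
    intro x hzx hxy hx
    obtain ⟨v, hv, rfl⟩ := List.mem_map.1 ((hr.isIn_outer hab x).1 hx)
    simp only [List.mem_append, List.mem_cons] at hv
    rcases hv with hv | rfl | hv
    · exact absurd hzx (h.order_z (by simp [hv]))
    · exact absurd rfl hxy
    · exact ⟨v, hv, rfl⟩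
  rcases h.adj_cases (by simp) hzy with e | e
  · rw [e] at hyb hTy
    by_cases hb : IsIn T b (below z.1)
    · obtain ⟨v, hv, ev⟩ := hQ _ (by simp [below, Prod.le_def])
        (by rw [e]; simp [below, right, Prod.ext_iff]) hb
      -- With two outer neighbours, `y` is the one that comes first in the standard order. This is
      -- the right one exactly if it is primed, in accordance with the rule.
      have hy2 : y.2 = true := by
        cases hy2 : y.2
        · have := ((hpy v hv).2 hy2).2
          simp [ev, e, below, right] at this
        · rfl
      rw [switchAt, if_pos ⟨hyb, hb⟩, if_pos (by rw [hTy, hy2]), e]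
    · rw [switchAt, if_neg (fun h => hb h.2), if_pos hyb, if_neg, e]
      rintro ⟨hd, h1, -⟩
      rw [hTy] at h1
      simp only [Option.some.injEq, Letter.mk.injEq, true_and] at h1
      exact h3 ⟨h1, hd⟩
  · rw [e] at hyb hTy
    have hA : ¬ AfterDiagonal T a z.1 := by
      rintro ⟨h1, h2, h3⟩
      obtain ⟨u, hu, eu⟩ := List.mem_map.1 ((hr.isIn_inner hab _).1 h3)
      simp only [List.mem_append, List.mem_cons] at hu
      rcases hu with hu | rfl | hu
      · refine h4 u hu ⟨by rw [eu], ?_⟩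
        rw [eu, e]
        simp only [below, right, Prod.ext_iff, true_and]
        omega
      · rw [Prod.ext_iff] at eu; simp only at eu; omega
      · refine h.order_S hu (v := z) (by simp) ?_
        rw [eu, Prod.le_def]; simp only; omega
    by_cases hb : IsIn T b (right z.1)
    · obtain ⟨v, hv, ev⟩ := hQ _ (by simp [right, Prod.le_def])
        (by rw [e]; simp [below, right, Prod.ext_iff]) hb
      have hTv : T (right z.1) = some ⟨b, v.2⟩ := ev ▸ hr.outer v (by simp [hv])
      have hv2 : v.2 = false := by
        cases hv2 : v.2
        · rfl
        · have := ((hpy v hv).1 hv2).2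
          simp [ev, e, below, right] at this
      rw [switchAt, if_pos ⟨hb, hyb⟩, if_neg (by rw [hTv, hv2]; simp), if_neg hA, e]
    · rw [switchAt, if_neg (fun h => hb h.1), if_neg hb, if_neg hA, e]

theorem Inv.step_normal (hab : a ≠ b) (h : Inv L P z (y :: Q) S)
    (hr : Rep a b T (L ++ z :: S) (P ++ y :: Q)) (hzy : Adj z.1 y.1)
    (h3 : ¬ (y.2 = true ∧ z.1.1 = z.1.2))
    (h4 : ∀ u ∈ L, ¬ (u.1.1 = u.1.2 ∧ y.1 = below (right u.1))) :
    ∃ T', Joins a b T T' ∧ Inv L (P ++ [(z.1, y.2)]) (y.1, z.2) Q S ∧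
      Rep a b T' (L ++ (y.1, z.2) :: S) (P ++ (z.1, y.2) :: Q) := by
  refine ⟨_, Joins.step T, h.of_adj hzy h3, ?_⟩
  rw [h.switchStep_eq hab hr (by simp) hzy, h.switchAt_eq_exchange hab hr hzy h3 h4]
  exact h.rep_exchange hr

/-- Exception (i) performs two elementary switches at once. The filling `T'` between them need not
occur in the process, but one step from `T` and one step from `T'` lead to the same filling. -/
theorem Inv.step_diag (hab : a ≠ b) (h : Inv L P z (y :: Q) S)
    (hr : Rep a b T (L ++ z :: S) (P ++ y :: Q)) (hzy : Adj z.1 y.1)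
    (hy : y.2 = true) (hz : z.1.1 = z.1.2) :
    ∃ T', Joins a b T T' ∧ Inv L (P ++ [(z.1, false)]) (y.1, z.2) Q S ∧
      Rep a b T' (L ++ (y.1, z.2) :: S) (P ++ (z.1, false) :: Q) := by
  obtain ⟨e, Q', rfl⟩ := h.next_of_diag hzy hy hz
  have hI := h.of_adj_diag hzy hy hz
  have hR : Rep a b (Function.update (exchange T z.1 y.1) z.1 (some ⟨b, false⟩))
      (L ++ (y.1, z.2) :: S) (P ++ (z.1, false) :: (below (right z.1), false) :: Q') := by
    refine (h.rep_exchange hr).update_outer (p := y.2) false fun u hu => ?_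
    by_cases hu' : u = (y.1, z.2)
    · rw [hu', e]; simp [right, Prod.ext_iff]
    · refine h.ne_z ?_
      simp only [List.mem_append, List.mem_cons] at hu ⊢
      tauto
  refine ⟨_, Joins.of_step_eq ?_, hI, hR⟩
  have hTy : T (right z.1) = some ⟨b, true⟩ := by rw [← e, ← hy]; exact hr.outer y (by simp)
  have hTv : T (below (right z.1)) = some ⟨b, false⟩ :=
    hr.outer (below (right z.1), false) (by simp)
  have hnb : ¬ IsIn T b (below z.1) := by
    rw [hr.isIn_outer hab]
    intro hm
    have := h.lin.valid (below z.1) (by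
      obtain ⟨v, hv, ev⟩ := List.mem_map.1 hm
      refine List.mem_map.2 ⟨v, ?_, ev⟩
      simp only [List.mem_append, List.mem_cons] at hv ⊢
      tauto)
    simp only [below] at this
    omega
  have hne1 : right z.1 ≠ z.1 := by simp [right, Prod.ext_iff]
  have hne2 : below (right z.1) ≠ z.1 := by simp [right, below, Prod.ext_iff]
  have hne3 : below (right z.1) ≠ right z.1 := by simp [right, below, Prod.ext_iff]
  rw [h.switchStep_eq hab hr (by simp) hzy,
    hI.switchStep_eq hab (by simpa using hR) (by simp) (y := (below (right z.1), false))
      (by rw [e]; exact .inr (.inl rfl)),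
    hI.switchAt_eq_exchange hab (by simpa using hR) (by rw [e]; exact .inr (.inl rfl)) (by simp)
      (fun u hu hd => ?_)]
  · rw [switchAt, if_neg (fun h => hnb h.2), if_pos (isIn_of_eq hTy),
      if_pos ⟨hz, hTy, isIn_of_eq hTv⟩]
    simp only [e]
    funext w
    by_cases h1 : w = z.1
    · subst h1
      simp [exchange, hne1.symm, hTv]
      rw [Equiv.swap_apply_of_ne_of_ne hne1.symm hne2.symm]
      simp
    · by_cases h2 : w = right z.1
      · subst h2
        simp [exchange, hne2]
        rw [Equiv.swap_apply_of_ne_of_ne hne2 hne3, hTv]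
      · by_cases h3 : w = below (right z.1)
        · subst h3
          simp [exchange, hne1, hne3]
        · simp [exchange, h2, Equiv.swap_apply_of_ne_of_ne h2 h3, Function.update_of_ne h1,
            Equiv.swap_apply_of_ne_of_ne h1 h2, Equiv.swap_apply_of_ne_of_ne h1 h3]
  · refine h.order_z (u := u) (by simp [hu]) ?_
    have : u.1 = z.1 := by
      have := hd.2
      simp only [below, right, Prod.ext_iff] at this ⊢
      omega
    rw [this]

/-- Exception (ii) also moves the letter waiting at `x`, whose own pass comes only later in standard
switching. `T'` makes just the switch of `z` and primes the letter at `x`; its next step is the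
switch of `x`, and the result is that of the exceptional step on `T`. -/
theorem Inv.step_exceptional (hab : a ≠ b) {x : Box} (h : Inv (L ++ [(x, false)]) P z (y :: Q) S)
    (hr : Rep a b T (L ++ [(x, false)] ++ z :: S) (P ++ y :: Q)) (hz2 : z.2 = false)
    (hd : x.1 = x.2) (hz : z.1 = right x) (hy : y.1 = below z.1)
    (hL : ∀ v ∈ L.getLast?, v.2 = true) :
    ∃ T', Joins a b T T' ∧ Inv (L ++ [(x, true)]) (P ++ [(z.1, y.2)]) (y.1, z.2) Q S ∧
      Rep a b T' (L ++ [(x, true)] ++ (y.1, z.2) :: S) (P ++ (z.1, y.2) :: Q) := by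
  have hzy : Adj z.1 y.1 := .inr (.inl hy)
  have hI := h.of_adj_exceptional hd hz hy hL
  have hyx : y.1 ≠ x := by rw [hy, hz]; simp [below, right, Prod.ext_iff]
  have hzx : z.1 ≠ x := by rw [hz]; simp [right, Prod.ext_iff]
  have hnd : ∀ u ∈ L ++ P ++ z :: y :: Q ++ S, u.1 ≠ x := by
    have hn := h.lin.nodup
    have e : L ++ [(x, false)] ++ P ++ z :: y :: Q ++ S =
      L ++ (x, false) :: (P ++ z :: y :: Q ++ S) := by simp
    rw [e, boxes, List.map_append, List.map_cons, List.nodup_middle, List.nodup_cons,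
      ← List.map_append] at hn
    intro u hu e
    have hm := List.mem_map_of_mem (f := Prod.fst)
      (show u ∈ L ++ (P ++ z :: y :: Q ++ S) by simpa using hu)
    rw [e] at hm
    exact hn.1 hm
  have hR : Rep a b (Function.update (exchange T z.1 y.1) x (some ⟨a, true⟩))
      (L ++ (x, true) :: (y.1, z.2) :: S) (P ++ (z.1, y.2) :: Q) := by
    refine Rep.update_inner (p := false) true (by simpa using h.rep_exchange hr) fun u hu => ?_
    by_cases hu' : u = (y.1, z.2)
    · rw [hu']; exact hyx
    · by_cases hu'' : u = (z.1, y.2)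
      · rw [hu'']; exact hzx
      · refine hnd u ?_
        simp only [List.mem_append, List.mem_cons] at hu ⊢
        tauto
  refine ⟨_, Joins.of_step_eq ?_, hI, by simpa using hR⟩
  -- At $(r+1,r+1)$ the moved letter has no neighbours in `Q`, and `x` has none in `P`. So the list
  -- can be reordered to the state in which `x` is the current box, which identifies the next step
  -- of `T'`.
  have hI' : Inv L P (x, true) ((z.1, y.2) :: Q) ((y.1, z.2) :: S) := by
    refine ⟨?_, ?_, by simpa using hI.outer, by simpa using hI.last, by simpa using hI.diag⟩
    · have h1 := LinExt.pass (A := boxes (L ++ [(x, true)] ++ P ++ [z])) (x := y.1) (ys := boxes Q)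
        (C := boxes S) (by simpa using hI.lin)
      rw [pass_eq_self] at h1
      · have h2 := LinExt.pass (A := boxes L) (x := x) (ys := boxes P)
          (C := boxes (z :: Q ++ (y.1, z.2) :: S)) (by simpa using h1)
        rw [pass_eq_self] at h2
        · simpa using h2
        · intro v hv hxv
          obtain ⟨v, hvP, rfl⟩ := List.mem_map.1 hv
          have hvv := h.lin.valid v.1 (List.mem_map_of_mem (by simp [hvP]))
          have hvx : ¬ v.1 ≤ x := by
            have ho := h.lin.order
            have e : L ++ [(x, false)] ++ P ++ z :: y :: Q ++ S =
              (L ++ [(x, false)]) ++ (P ++ z :: y :: Q ++ S) := by simp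
            rw [e, boxes, List.map_append, List.pairwise_append] at ho
            exact ho.2.2 x (by simp) v.1 (List.mem_map_of_mem (by simp [hvP]))
          have hvz := h.ne_z (u := v) (by simp [hvP])
          rw [hz] at hvz
          simp only [Adj, right, below, Prod.ext_iff, Prod.le_def, ne_eq] at *
          omega
      · intro v hv
        obtain ⟨v, hvQ, rfl⟩ := List.mem_map.1 hv
        exact hI.not_adj_of_diag (u := (x, true)) (by simp) hd (by rw [← hz]; exact hy) hvQ
    · have := hI.inner
      rw [List.isChain_append] at this
      exact this.1
  have hTz : T z.1 = some ⟨a, false⟩ := hz2 ▸ hr.inner z (by simp)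
  have hTx : T x = some ⟨a, false⟩ := hr.inner (x, false) (by simp)
  have hTy : T y.1 = some ⟨b, y.2⟩ := hr.outer y (by simp)
  have hA : AfterDiagonal T a z.1 := by
    refine ⟨by rw [hz]; simp only [right]; omega, hTz, ?_⟩
    have : ((z.1.1, z.1.1) : Box) = x := by
      rw [hz, Prod.ext_iff]; simp only [right, true_and]; omega
    rw [this]
    exact isIn_of_eq hTx
  have hbelow : IsIn T b (below z.1) := hy ▸ isIn_of_eq hTy
  have hright : T (right z.1) ≠ some ⟨b, true⟩ := by
    intro he
    obtain ⟨v, hv, ev⟩ := List.mem_map.1 ((hr.isIn_outer hab _).1 (isIn_of_eq he))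
    have hTv := hr.outer v hv
    rw [ev, he] at hTv
    simp only [Option.some.injEq, Letter.mk.injEq, true_and] at hTv
    simp only [List.mem_append, List.mem_cons] at hv
    rcases hv with hv | rfl | hv
    · refine h.order_z (u := v) (by simp [hv]) ?_
      rw [ev]; simp [right, Prod.le_def]
    · rw [hy] at ev; simp [right, below, Prod.ext_iff] at ev
    · have hpy := (List.pairwise_cons.1
        (List.pairwise_append.1 (pairwise_precedes h.outer)).2.1).1 v hv
      have := (hpy.1 hTv.symm).2
      rw [hy, ev] at this
      simp [right, below] at this
  have hxz : ((z.1.1, z.1.1) : Box) = x := by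
    rw [hz, Prod.ext_iff]; simp only [right, true_and]; omega
  have hAdj : Adj x z.1 := .inl hz
  rw [h.switchStep_eq hab hr (by simp) hzy,
    hI'.switchStep_eq hab (T := Function.update _ _ _) (by simpa using hR) (by simp)
      (y := (z.1, y.2)) hAdj]
  have hsw : switchAt T a b z.1 =
      Function.update (exchange T x (below z.1)) z.1 (some ⟨a, true⟩) := by
    by_cases hb : IsIn T b (right z.1)
    · rw [switchAt, if_pos ⟨hb, hbelow⟩, if_neg hright, if_pos hA, hxz]
    · rw [switchAt, if_neg (fun h => hb h.1), if_neg hb, if_pos hA, hxz]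
  set T' := Function.update (exchange T z.1 y.1) x (some ⟨a, true⟩) with hT'
  have hT'z : T' z.1 = some ⟨b, y.2⟩ := by
    rw [hT', Function.update_of_ne hzx]; simp [exchange, hTy]
  have hT'y : T' y.1 = some ⟨a, false⟩ := by
    rw [hT', Function.update_of_ne hyx]; simp [exchange, hTz]
  have hsw' : switchAt T' a b x = exchange T' x z.1 := by
    have h1 : ¬ IsIn T' b (below x) := by
      rw [hR.isIn_outer hab]
      intro hm
      have := hI'.lin.valid (below x) (by
        obtain ⟨v, hv, ev⟩ := List.mem_map.1 hm
        refine List.mem_map.2 ⟨v, ?_, ev⟩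
        simp only [List.mem_append, List.mem_cons] at hv ⊢
        tauto)
      simp only [below] at this
      omega
    have h2 : ¬ IsIn T' b (below (right x)) := by
      rintro ⟨l, hl, e⟩
      rw [← hz, ← hy, hT'y] at hl
      simp only [Option.some.injEq] at hl
      rw [← hl] at e
      exact hab e
    rw [switchAt, if_neg (fun h => h1 h.2), if_pos (by rw [← hz]; exact isIn_of_eq hT'z),
      if_neg (fun h => h2 h.2.2), hz]
  rw [hsw]
  change _ = switchAt T' a b x
  rw [hsw', ← hy, hT']
  have hyz : y.1 ≠ z.1 := by rw [hy]; simp [below, Prod.ext_iff]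
  funext w
  by_cases h1 : w = z.1
  · subst h1
    simp [exchange]
  · by_cases h2 : w = x
    · subst h2
      simp [exchange, hzx, hzx.symm]
    · by_cases h3 : w = y.1
      · subst h3
        simp [exchange, hyz, hTx]
        rw [Equiv.swap_apply_of_ne_of_ne hyx hyz, Function.update_of_ne hyx]
        simp [hTz]
      · simp [exchange, Function.update_of_ne h1, Function.update_of_ne h2,
          Equiv.swap_apply_of_ne_of_ne h2 h3, Equiv.swap_apply_of_ne_of_ne h2 h1,
          Equiv.swap_apply_of_ne_of_ne h1 h3]

end

section
variable {a b : ℕ+} {T : Filling} {L P Q S : List LBox} {z y : LBox}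

/-- Each elementary switch of standard switching is matched here: by no change, by exception (ii),
by exception (i), or by an ordinary exchange. The use of `primeDiag` records the prime that
exception (ii) has added. -/
theorem Inv.step (hab : a ≠ b) (h : Inv (primeDiag z.1 L) P z (y :: Q) S)
    (hr : Rep a b T (primeDiag z.1 L ++ z :: S) (P ++ y :: Q)) :
    ∃ T' q, Joins a b T T' ∧
      Inv (primeDiag (elemSwitch z.1 y.1).2 L) (P ++ [((elemSwitch z.1 y.1).1, q)])
        ((elemSwitch z.1 y.1).2, z.2) Q S ∧
      Rep a b T' (primeDiag (elemSwitch z.1 y.1).2 L ++ ((elemSwitch z.1 y.1).2, z.2) :: S)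
        (P ++ ((elemSwitch z.1 y.1).1, q) :: Q) := by
  by_cases hzy : Adj z.1 y.1
  · simp only [elemSwitch, hzy, if_true]
    have hpd := Inv.primeDiag_of_adj (L := L) h (y := y) (by simp) hzy
    rw [hpd] at h hr
    by_cases h4 : ∃ u ∈ L, u.1.1 = u.1.2 ∧ y.1 = below (right u.1)
    · obtain ⟨u, hu, hd, hy⟩ := h4
      have hvz := h.lin.valid z.1 (by simp)
      have hz : z.1 = right u.1 ∧ y.1 = below z.1 := by
        have := h.adj_cases (y := y) (by simp) hzy
        simp only [right, below, Prod.ext_iff] at *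
        omega
      obtain ⟨hz2, L', rfl, hL'⟩ := h.exceptional hu hd hz.1
      have hL : primeDiag y.1 (L' ++ [(u.1, false)]) = L' ++ [(u.1, true)] := by
        rw [primeDiag, List.map_append, ← primeDiag, primeDiag_eq_self]
        · simp [hd, hy]
        · rintro v hv ⟨-, e⟩
          have hn := h.lin.nodup
          have e' : L' ++ [(u.1, false)] ++ P ++ z :: y :: Q ++ S =
            L' ++ (u.1, false) :: (P ++ z :: y :: Q ++ S) := by simp
          rw [e', boxes, List.map_append, List.map_cons, List.nodup_middle, List.nodup_cons] at hn
          refine hn.1 (List.mem_append_left _ (List.mem_map.2 ⟨v, hv, ?_⟩))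
          rw [hy] at e
          simp only [right, below, Prod.ext_iff] at e ⊢
          omega
      rw [hL]
      obtain ⟨T', h1, h2, h3⟩ := h.step_exceptional hab hr hz2 hd hz.1 hz.2 hL'
      exact ⟨T', y.2, h1, h2, h3⟩
    · push Not at h4
      rw [primeDiag_eq_self fun u hu hd => h4 u hu hd.1 hd.2]
      by_cases h3 : y.2 = true ∧ z.1.1 = z.1.2
      · obtain ⟨T', hT'⟩ := h.step_diag hab hr hzy h3.1 h3.2
        exact ⟨T', false, hT'⟩
      · obtain ⟨T', hT'⟩ := h.step_normal hab hr hzy h3 fun u hu hd => h4 u hu hd.1 hd.2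
        exact ⟨T', y.2, hT'⟩
  · simp only [elemSwitch, hzy, if_false]
    exact ⟨T, y.2, Joins.refl T, h.of_not_adj hzy, hr⟩

theorem Inv.pass (hab : a ≠ b) (h : Inv (primeDiag z.1 L) P z Q S)
    (hr : Rep a b T (primeDiag z.1 L ++ z :: S) (P ++ Q)) :
    ∃ T' Q', Joins a b T T' ∧ boxes Q' = (ShiftedBK.pass z.1 (boxes Q)).1 ∧
      Inv (primeDiag (ShiftedBK.pass z.1 (boxes Q)).2 L) (P ++ Q')
        ((ShiftedBK.pass z.1 (boxes Q)).2, z.2) [] S ∧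
      Rep a b T' (primeDiag (ShiftedBK.pass z.1 (boxes Q)).2 L ++
        ((ShiftedBK.pass z.1 (boxes Q)).2, z.2) :: S) (P ++ Q') := by
  induction Q generalizing P z T with
  | nil => exact ⟨T, [], Joins.refl T, rfl, by simpa [ShiftedBK.pass] using h,
      by simpa [ShiftedBK.pass] using hr⟩
  | cons y Q ih =>
    obtain ⟨T', q, h1, h2, h3⟩ := h.step hab hr
    obtain ⟨T'', Q', k1, k2, k3, k4⟩ := ih (z := ((elemSwitch z.1 y.1).2, z.2)) h2 (by simpa using h3)
    refine ⟨T'', ((elemSwitch z.1 y.1).1, q) :: Q', h1.trans k1, ?_, ?_, ?_⟩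
    · simp [ShiftedBK.pass, ← k2]
    · simpa [ShiftedBK.pass] using k3
    · simpa [ShiftedBK.pass] using k4

/-! ### The whole process -/

/-- The switching process after the last letters have been moved: those in `L` are left. -/
structure Between (a b : ℕ+) (T : Filling) (L bs S : List LBox) : Prop where
  lin : LinExt (boxes (L ++ bs ++ S))
  inner : L.IsChain Follows
  outer : bs.IsChain Follows
  last : ∀ u ∈ bs.getLast?, u.2 = false
  diag : ∀ u ∈ bs, u.2 = true → u.1.1 ≠ u.1.2
  settled : S.IsChain Follows
  inner_last : ∀ u ∈ (L ++ S).getLast?, u.2 = false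
  link : ∀ x ∈ L.getLast?, ∀ s ∈ S.head?, Follows ((pass x.1 (boxes bs)).2, x.2) s
  rep : Rep a b T (L ++ S) bs

/-- After a pass, the settled letters must again be in standard order. The field `link` supplies
this for the letter just moved, and has to be re-established for the next one from the results on
two successive passes. -/
theorem Between.next (hab : a ≠ b) {bs : List LBox} (h : Between a b T (L ++ [z]) bs S) :
    ∃ T' bs', Joins a b T T' ∧ boxes bs' = (pass z.1 (boxes bs)).1 ∧
      Between a b T' (primeDiag (pass z.1 (boxes bs)).2 L) bs'
        (((pass z.1 (boxes bs)).2, z.2) :: S) := by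
  have hI : Inv L [] z bs S :=
    ⟨by simpa using h.lin, h.inner, by simpa using h.outer, by simpa using h.last,
      by simpa using h.diag⟩
  have hp := hI.primeDiag_start
  obtain ⟨T', bs', h1, h2, h3, h4⟩ := Inv.pass (L := L) (P := []) (z := z) (T := T) hab
    (by rw [hp]; exact hI) (by rw [hp]; simpa using h.rep)
  refine ⟨T', bs', h1, h2, ?_⟩
  have hin := h3.inner
  rw [List.isChain_append] at hin
  refine ⟨by simpa using h3.lin, hin.1, by simpa using h3.outer, by simpa using h3.last,
    by simpa using h3.diag, ?_, ?_, ?_, by simpa using h4⟩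
  · rw [List.isChain_cons]
    exact ⟨fun s hs => h.link z (by simp) s hs, h.settled⟩
  · have := h.inner_last
    cases S <;> simp_all
  · intro x hx s hs
    simp only [List.head?_cons, Option.mem_def, Option.some.injEq] at hs
    subst hs
    simp only [primeDiag, List.getLast?_map, Option.mem_def, Option.map_eq_some_iff] at hx
    obtain ⟨u, hu, rfl⟩ := hx
    obtain ⟨L', rfl⟩ := List.getLast?_eq_some_iff.1 hu
    have huz : Follows u z := by
      have := h.inner
      rw [List.isChain_append] at this
      exact this.2.2 u (by simp) z (by simp)
    have hlin : LinExt (u.1 :: z.1 :: boxes bs) :=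
      LinExt.infix (A := boxes L') (C := boxes S) (by simpa using h.lin)
    rw [h2]
    cases hu2 : u.2
    -- The two alternatives are exactly whether `primeDiag` has primed `u`: primed letters are
    -- compared by rows, unprimed ones by columns.
    · rcases pass_pair_cols hlin h.outer (huz.2 hu2).2 with ⟨d1, d2, d3⟩ | ⟨d1, d2⟩
      · rw [if_pos ⟨d1, d2⟩]
        exact ⟨fun _ => d3, by simp⟩
      · rw [if_neg d1]
        exact ⟨by simp [hu2], fun _ => ⟨(huz.2 hu2).1, d2⟩⟩
    · have := pass_pair_rows hlin (huz.1 hu2)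
      split_ifs <;> exact ⟨fun _ => this, by simp [hu2]⟩

theorem Between.finish (hab : a ≠ b) {bs : List LBox} (h : Between a b T L bs S) :
    ∃ T' as' bs', Joins a b T T' ∧ Between a b T' [] bs' as' ∧
      (boxes bs', boxes as') = passAll (boxes L) (boxes bs) (boxes S) := by
  induction hn : L.length generalizing T L bs S with
  | zero =>
    rw [List.length_eq_zero_iff] at hn
    subst hn
    exact ⟨T, S, bs, Joins.refl T, h, rfl⟩
  | succ n ih =>
    rcases List.eq_nil_or_concat L with rfl | ⟨L', z, rfl⟩
    · simp at hn
    · rw [List.concat_eq_append] at h hn ⊢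
      obtain ⟨T', bs', h1, h2, h3⟩ := h.next hab
      obtain ⟨T'', as'', bs'', k1, k2, k3⟩ := ih h3 (by simpa [primeDiag] using hn)
      refine ⟨T'', as'', bs'', h1.trans k1, k2, ?_⟩
      have e : boxes (L' ++ [z]) = boxes L' ++ [z.1] := by simp
      rw [k3, boxes_primeDiag, h2, e, passAll_concat]
      rfl

end

theorem switchStep_of_fullySwitched {a b : ℕ+} {T : Filling} (h : FullySwitched T a b) :
    switchStep a b T = T := by
  rw [switchStep, dif_neg]
  rintro ⟨x, hx, -⟩
  exact h x hx

/-- A fully switched filling is a fixed point of the step. Hence the orbit of `T` reaches `T'`, and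
it is already constant from the least stopping time on. -/
theorem switching_eq_of_joins {a b : ℕ+} {T T' : Filling} (h : Joins a b T T')
    (hT' : FullySwitched T' a b) : switching a b T = T' := by
  obtain ⟨m, n, e⟩ := h
  rw [Function.iterate_fixed (switchStep_of_fullySwitched hT')] at e
  set s := sInf {m : ℕ | FullySwitched ((switchStep a b)^[m] T) a b} with hs
  have hm : m ∈ {m : ℕ | FullySwitched ((switchStep a b)^[m] T) a b} := by
    rw [Set.mem_ofPred_eq, e]; exact hT'
  have h1 : FullySwitched ((switchStep a b)^[s] T) a b := Nat.sInf_mem ⟨m, hm⟩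
  have h2 : s ≤ m := Nat.sInf_le hm
  rw [switching, ← e, ← Nat.sub_add_cancel h2, Function.iterate_add_apply,
    Function.iterate_fixed (switchStep_of_fullySwitched h1)]

/-- `as` and `bs` are the standard orders of the **a**-boxes and of the **b**-boxes of `T`. -/
structure Standard (a b : ℕ+) (T : Filling) (as bs : List LBox) : Prop where
  lin : LinExt (boxes (as ++ bs))
  inner : as.IsChain Follows
  inner_last : ∀ u ∈ as.getLast?, u.2 = false
  outer : bs.IsChain Follows
  outer_last : ∀ u ∈ bs.getLast?, u.2 = false
  rep : Rep a b T as bs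

/-- The successor of a primed diagonal box would be strictly lower, hence also strictly further
right, but consecutive comparable boxes are neighbours. -/
theorem not_diag_of_primed {l : List LBox} (hl : LinExt (boxes l)) (h : l.IsChain Follows)
    (h' : ∀ u ∈ l.getLast?, u.2 = false) {u : LBox} (hu : u ∈ l) (hp : u.2 = true) :
    u.1.1 ≠ u.1.2 := by
  obtain ⟨A, B, rfl⟩ := List.append_of_mem hu
  match B with
  | [] => have := h' u (by simp); simp [hp] at this
  | v :: B =>
    rw [List.isChain_append, List.isChain_cons_cons] at h
    have hr := h.2.1.1.1 hp
    have hv := hl.valid v.1 (by simp)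
    intro hd
    have := LinExt.next_of_le (A := boxes A) (x := u.1) (y := v.1) (C := boxes B)
      (by simpa using hl) (by simp only [Prod.le_def]; omega)
    simp only [right, below, Prod.ext_iff] at this
    omega

theorem Standard.switching {a b : ℕ+} {T : Filling} {as bs : List LBox} (hab : a ≠ b)
    (h : Standard a b T as bs) :
    ∃ as' bs', Standard b a (switching a b T) bs' as' ∧
      (boxes bs', boxes as') = passAll (boxes as) (boxes bs) [] := by
  have hb : LinExt (boxes bs) :=
    LinExt.infix (A := boxes as) (C := []) (by simpa using h.lin)
  have hB : Between a b T as bs [] :=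
    ⟨by simpa using h.lin, h.inner, h.outer, h.outer_last,
      fun u hu => not_diag_of_primed hb h.outer h.outer_last hu, by simp,
      by simpa using h.inner_last, by simp, by simpa using h.rep⟩
  obtain ⟨T', as', bs', h1, h2, h3⟩ := hB.finish hab
  have hf : FullySwitched T' a b := by
    rintro x ⟨hx, hx'⟩
    have hr : Rep a b T' as' bs' := h2.rep
    rw [hr.isIn_inner hab] at hx
    rw [hr.isIn_outer hab, hr.isIn_outer hab] at hx'
    have ho := h2.lin.order
    rw [List.nil_append, boxes, List.map_append, List.pairwise_append] at ho
    rcases hx' with hx' | hx'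
    · exact ho.2.2 _ hx' _ hx (by simp [right, Prod.le_def])
    · exact ho.2.2 _ hx' _ hx (by simp [below, Prod.le_def])
  refine ⟨as', bs', ?_, h3⟩
  rw [switching_eq_of_joins h1 hf]
  exact ⟨h2.lin, h2.outer, h2.last, h2.settled, h2.inner_last, Rep.symm h2.rep⟩

/-- The primes are determined by the order of the boxes. -/
theorem eq_of_boxes_eq {l l' : List LBox} (hl : LinExt (boxes l)) (h : l.IsChain Follows)
    (h1 : ∀ u ∈ l.getLast?, u.2 = false) (h' : l'.IsChain Follows)
    (h1' : ∀ u ∈ l'.getLast?, u.2 = false) (he : boxes l' = boxes l) : l' = l := by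
  induction l generalizing l' with
  | nil => simpa using he
  | cons u l ih =>
    match l' with
    | [] => simp at he
    | u' :: l' =>
      simp only [boxes, List.map_cons, List.cons.injEq] at he
      have hl' := LinExt.of_cons (x := u.1) (w := boxes l) hl
      rw [List.isChain_cons] at h h'
      have e := ih hl' h.2 (fun v hv => h1 v (by simp [List.getLast?_cons, Option.mem_def.1 hv])) h'.2
        (fun v hv => h1' v (by simp [List.getLast?_cons, Option.mem_def.1 hv])) he.2
      subst e
      rw [List.cons.injEq]
      refine ⟨Prod.ext he.1 ?_, rfl⟩
      match l' with
      | [] => rw [h1 u (by simp), h1' u' (by simp)]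
      | v :: l' =>
        have k := h.1 v (by simp)
        have k' := h'.1 v (by simp)
        rw [Follows, he.1] at k'
        have hn := fun hle => LinExt.next_of_le (A := []) (x := u.1) (y := v.1) (C := boxes l')
          hl hle
        -- Two different labels of `u` would make `v` both strictly lower and strictly further
        -- right, which is impossible for consecutive boxes. At the end of the list the label is
        -- unprimed by hypothesis.
        have key : ¬ (u.1.1 < v.1.1 ∧ u.1.2 < v.1.2) := fun ⟨k1, k2⟩ => by
          have := hn ⟨k1.le, k2.le⟩
          simp only [right, below, Prod.ext_iff] at this
          omega
        cases hp : u.2 <;> cases hp' : u'.2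
        · rfl
        · exact absurd ⟨k'.1 hp', (k.2 hp).2⟩ key
        · exact absurd ⟨k.1 hp, (k'.2 hp').2⟩ key
        · rfl

/-! ### The standard order of a tableau -/

theorem Letter.le_refl (x : Letter) : x.le x := .inr ⟨rfl, by cases x.primed <;> simp⟩

theorem Letter.le_trans {x y z : Letter} (h1 : x.le y) (h2 : y.le z) : x.le z := by
  rcases h1 with h1 | ⟨h1, h1'⟩ <;> rcases h2 with h2 | ⟨h2, h2'⟩
  · exact .inl (h1.trans h2)
  · exact .inl (h2 ▸ h1)
  · exact .inl (h1 ▸ h2)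
  · refine .inr ⟨h1.trans h2, ?_⟩
    rcases h1' with h | h
    · exact .inl h
    · rcases h2' with h' | h'
      · simp [h] at h'
      · exact .inr h'

theorem Letter.le.idx_le {x y : Letter} (h : x.le y) : x.idx ≤ y.idx := by
  rcases h with h | h
  · exact h.le
  · exact h.1.le

theorem StrictPartition.getD_succ_lt (l : StrictPartition) {s : ℕ}
    (h : 0 < l.parts.getD (s + 1) 0) : l.parts.getD (s + 1) 0 < l.parts.getD s 0 := by
  have hs : s + 1 < l.parts.length := by
    by_contra hs
    rw [List.getD_eq_default _ _ (by omega)] at h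
    exact lt_irrefl _ h
  rw [List.getD_eq_getElem _ _ hs, List.getD_eq_getElem _ _ (by omega)]
  exact List.pairwise_iff_getElem.1 l.decreasing s (s + 1) (by omega) hs (by omega)

theorem StrictPartition.add_getD_le (l : StrictPartition) {r s : ℕ} (hrs : r ≤ s)
    (h : 0 < l.parts.getD s 0) : s + l.parts.getD s 0 ≤ r + l.parts.getD r 0 := by
  induction s, hrs using Nat.le_induction with
  | base => exact le_rfl
  | succ s hs ih =>
    have := l.getD_succ_lt h
    have := ih (by omega)
    omega

theorem StrictPartition.mem_shape_of_le (l : StrictPartition) {x y : Box} (hy : y ∈ l.shape)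
    (hxy : x ≤ y) (hx : x.1 ≤ x.2) : x ∈ l.shape := by
  have h1 : y.1 ≤ y.2 ∧ y.2 < y.1 + l.parts.getD y.1 0 := hy
  have := l.add_getD_le hxy.1 (by omega)
  have h2 := hxy.2
  exact ⟨hx, by omega⟩

theorem StrictPartition.finite_shape (l : StrictPartition) : l.shape.Finite := by
  refine (Set.finite_Iic ((l.parts.length, l.parts.length + l.parts.sum) : Box)).subset ?_
  rintro ⟨r, c⟩ ⟨h1, h2⟩
  simp only at h1 h2
  have hr : r < l.parts.length := by
    by_contra hr
    rw [List.getD_eq_default _ _ (by omega)] at h2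
    omega
  rw [List.getD_eq_getElem _ _ hr] at h2
  have := List.le_sum_of_mem (List.getElem_mem hr)
  exact ⟨hr.le, by simp only; omega⟩

theorem exists_sorted_list {s : Set Box} (hs : s.Finite) (f : Box → ℕ) (hf : Set.InjOn f s) :
    ∃ w : List Box, (∀ x, x ∈ w ↔ x ∈ s) ∧ w.Pairwise fun x y => f x < f y := by
  have : Std.Total (fun x y : Box => f x ≤ f y) := ⟨fun x y => le_total (f x) (f y)⟩
  have : IsTrans Box (fun x y : Box => f x ≤ f y) := ⟨fun _ _ _ => _root_.le_trans⟩
  refine ⟨hs.toFinset.toList.insertionSort fun x y => f x ≤ f y, fun x => by simp, ?_⟩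
  have h1 := List.pairwise_insertionSort (fun x y : Box => f x ≤ f y) hs.toFinset.toList
  have h2 : (hs.toFinset.toList.insertionSort fun x y => f x ≤ f y).Nodup :=
    (List.perm_insertionSort _ _).nodup_iff.2 (Finset.nodup_toList _)
  refine (h1.and h2).imp_of_mem fun {x y} hx hy hxy => lt_of_le_of_ne hxy.1 fun e => hxy.2 ?_
  exact hf (by simpa using hx) (by simpa using hy) e

section
variable {l m : StrictPartition} {T : Filling}

theorem IsShST.mem (h : IsShST l m T) {x : Box} {k : Letter} (hx : T x = some k) :
    x ∈ l.shape \ m.shape := (h.filled x).1 (by simp [hx])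

theorem IsShST.exists_letter (h : IsShST l m T) {x y z : Box} {k k' : Letter} (hx : T x = some k)
    (hz : T z = some k') (hxy : x ≤ y) (hyz : y ≤ z) (hy : y.1 ≤ y.2) : ∃ k'', T y = some k'' := by
  rw [← Option.ne_none_iff_exists', h.filled]
  exact ⟨l.mem_shape_of_le (h.mem hz).1 hyz hy, fun hm =>
    (h.mem hx).2 (m.mem_shape_of_le hm hxy (h.mem hx).1.1)⟩

theorem IsShST.le_of_le (h : IsShST l m T) {x y : Box} {k k' : Letter} (hx : T x = some k)
    (hy : T y = some k') (hxy : x ≤ y) : k.le k' := by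
  obtain ⟨r, c⟩ := x
  obtain ⟨s, d⟩ := y
  have hv : r ≤ c := (h.mem hx).1.1
  simp only [Prod.mk_le_mk] at hxy
  obtain ⟨k₀, hk₀⟩ := h.exists_letter (y := (r, d)) hx hy ⟨le_rfl, hxy.2⟩ ⟨hxy.1, le_rfl⟩
    (hv.trans hxy.2)
  have h1 : k.le k₀ := by
    rcases hxy.2.lt_or_eq with hlt | rfl
    · exact h.row_weak r c d _ _ hlt hx hk₀
    · rw [hx, Option.some.injEq] at hk₀; rw [hk₀]; exact Letter.le_refl _
  have h2 : k₀.le k' := by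
    rcases hxy.1.lt_or_eq with hlt | rfl
    · exact h.col_weak r s d _ _ hlt hk₀ hy
    · rw [hy, Option.some.injEq] at hk₀; rw [hk₀]; exact Letter.le_refl _
  exact Letter.le_trans h1 h2

theorem IsShST.finite (h : IsShST l m T) (k : Option Letter) (hk : k ≠ none) :
    {x | T x = k}.Finite :=
  l.finite_shape.subset fun x (hx : T x = k) => ((h.filled x).1 (hx ▸ hk)).1

theorem IsShST.exists_first (h : IsShST l m T) {a : ℕ+} {x : Box} (hx : IsIn T a x) :
    ∃ f, T f = some ⟨a, false⟩ ∧ ∀ y, IsIn T a y → y.1 < f.1 ∨ (y.1 = f.1 ∧ f.2 ≤ y.2) := by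
  have hfin : {y | IsIn T a y}.Finite :=
    l.finite_shape.subset fun y ⟨k, hk, _⟩ => (h.mem hk).1
  obtain ⟨g, hg, hg'⟩ := Set.exists_max_image _ Prod.fst hfin ⟨x, hx⟩
  obtain ⟨f, hf, hf'⟩ := Set.exists_min_image {y | IsIn T a y ∧ y.1 = g.1} Prod.snd
    (hfin.subset fun y hy => hy.1) ⟨g, hg, rfl⟩
  have hle : ∀ y, IsIn T a y → y.1 < f.1 ∨ (y.1 = f.1 ∧ f.2 ≤ y.2) := fun y hy => by
    rcases (hg' y hy).lt_or_eq with hlt | he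
    · exact .inl (hf.2 ▸ hlt)
    · exact .inr ⟨he.trans hf.2.symm, hf' y ⟨hy, he⟩⟩
  refine ⟨f, ?_, hle⟩
  obtain ⟨⟨i, p⟩, hk, hi⟩ := hf.1
  simp only at hi
  subst hi
  have := h.canonical f _ hk fun y hy hy' => by
    rcases hle y hy' with h1 | ⟨h1, h2⟩ <;> rcases hy with h3 | ⟨h3, h4⟩ <;> omega
  simp only at this
  rw [hk, this]

/-- The row and column conditions order the primed and the unprimed boxes separately; canonical form
makes the two runs fit together and the last box unprimed. -/
theorem IsShST.exists_list (h : IsShST l m T) (a : ℕ+) :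
    ∃ as : List LBox, (∀ u, u ∈ as ↔ T u.1 = some ⟨a, u.2⟩) ∧ as.IsChain Follows ∧
      ∀ u ∈ as.getLast?, u.2 = false := by
  obtain ⟨w, hw, hw'⟩ := exists_sorted_list (h.finite (some ⟨a, true⟩) (by simp)) Prod.fst (by
    rintro ⟨r, c⟩ hx ⟨s, d⟩ hy (rfl : r = s)
    rw [h.row_primed a r c d hx hy])
  obtain ⟨v, hv, hv'⟩ := exists_sorted_list (h.finite (some ⟨a, false⟩) (by simp)) Prod.snd (by
    rintro ⟨r, c⟩ hx ⟨s, d⟩ hy (rfl : c = d)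
    rw [h.col_unprimed a r s c hx hy])
  simp only [Set.mem_ofPred_eq] at hw hv
  refine ⟨w.map (·, true) ++ v.map (·, false), ?_, ?_, ?_⟩
  · rintro ⟨x, p⟩
    cases p <;> simp [hw, hv]
  · rw [List.isChain_append, List.isChain_map, List.isChain_map]
    refine ⟨(hw'.imp fun {x y} hxy => ?_).isChain, (hv'.imp fun {x y} hxy => ?_).isChain, ?_⟩
    · exact ⟨fun _ => hxy, by simp⟩
    · exact ⟨by simp, fun _ => ⟨rfl, hxy⟩⟩
    · intro x hx y hy
      simp only [List.getLast?_map, List.head?_map, Option.mem_def, Option.map_eq_some_iff] at hx hy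
      obtain ⟨x, hx, rfl⟩ := hx
      obtain ⟨y, hy, rfl⟩ := hy
      refine ⟨fun _ => ?_, by simp⟩
      simp only
      have hxT := (hw x).1 (List.mem_of_getLast? hx)
      have hyT := (hv y).1 (List.mem_of_head? hy)
      -- Let `f` be the first occurrence in reading order, unprimed and strictly below `x`. If `y`
      -- were not below `x`, the box in the row of `y` and the column of `f` would contain a second
      -- unprimed `a` in that column.
      obtain ⟨f, hf, hf'⟩ := h.exists_first ⟨_, hxT, rfl⟩
      have hxf : x.1 < f.1 := by
        rcases hf' x ⟨_, hxT, rfl⟩ with h1 | ⟨h1, h2⟩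
        · exact h1
        · have := h.le_of_le hf hxT ⟨h1.ge, h2⟩
          simp [Letter.le] at this
      by_contra hlt
      have hyf : y.2 ≤ f.2 := by
        obtain ⟨v', rfl⟩ := List.head?_eq_some_iff.1 hy
        rcases List.mem_cons.1 ((hv f).2 hf) with rfl | hm
        · exact le_rfl
        · exact ((List.pairwise_cons.1 hv').1 f hm).le
      have hyv : y.1 ≤ y.2 := (h.mem hyT).1.1
      obtain ⟨k, hk⟩ := h.exists_letter (y := (y.1, f.2)) hyT hf ⟨le_rfl, hyf⟩
        ⟨by simp only; omega, le_rfl⟩ (hyv.trans hyf)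
      have h1 := h.le_of_le hyT hk ⟨le_rfl, hyf⟩
      have h2 := h.le_of_le hk hf ⟨by simp only; omega, le_rfl⟩
      have h3 : k.idx = a := le_antisymm h2.idx_le h1.idx_le
      obtain ⟨i, p⟩ := k
      simp only at h3
      subst h3
      have hp : p = false := by
        rcases h1 with h1 | ⟨-, h1⟩
        · exact absurd h1 (lt_irrefl _)
        · simpa using h1
      subst hp
      have := h.col_unprimed i y.1 f.1 f.2 hk hf
      omega
  · intro u hu
    by_cases hvn : v = []
    · subst hvn
      simp only [List.map_nil, List.append_nil, List.getLast?_map, Option.mem_def,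
        Option.map_eq_some_iff] at hu
      obtain ⟨x, hx, rfl⟩ := hu
      obtain ⟨f, hf, -⟩ := h.exists_first ⟨_, (hw x).1 (List.mem_of_getLast? hx), rfl⟩
      exact absurd ((hv f).2 hf) (by simp)
    · rw [List.getLast?_append_of_ne_nil _ (by simpa using hvn), List.getLast?_map] at hu
      simp only [Option.mem_def, Option.map_eq_some_iff] at hu
      obtain ⟨x, -, rfl⟩ := hu
      rfl

theorem IsShST.exists_standard (h : IsShST l m T) (a : ℕ+) :
    ∃ as bs, Standard a (a + 1) T as bs := by
  obtain ⟨as, ha, ha', ha''⟩ := h.exists_list a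
  obtain ⟨bs, hb, hb', hb''⟩ := h.exists_list (a + 1)
  have hlt : a < a + 1 := PNat.lt_add_right a 1
  refine ⟨as, bs, ⟨?_, ?_, ?_⟩, ha', ha'', hb', hb'', fun u hu => (ha u).1 hu,
    fun u hu => (hb u).1 hu, fun x h1 h2 => ⟨?_, ?_⟩⟩
  · intro x hx
    obtain ⟨u, hu, rfl⟩ := List.mem_map.1 hx
    rcases List.mem_append.1 hu with hu | hu
    · exact (h.mem ((ha u).1 hu)).1.1
    · exact (h.mem ((hb u).1 hu)).1.1
  · have key : ∀ {c : ℕ+} {u v : LBox}, T u.1 = some ⟨c, u.2⟩ → T v.1 = some ⟨c, v.2⟩ →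
        Precedes u v → ¬ v.1 ≤ u.1 := by
      intro c u v hu hv huv hle
      rcases h.le_of_le hv hu hle with h1 | ⟨-, h1 | h1⟩
      · exact lt_irrefl _ h1
      · exact absurd hle.1 (by have := (huv.1 h1).2; omega)
      · exact absurd hle.2 (by have := (huv.2 h1).2; omega)
    rw [boxes, List.pairwise_map, List.pairwise_append]
    refine ⟨(pairwise_precedes ha').imp_of_mem fun hu hv => key ((ha _).1 hu) ((ha _).1 hv),
      (pairwise_precedes hb').imp_of_mem fun hu hv => key ((hb _).1 hu) ((hb _).1 hv), ?_⟩
    intro u hu v hv hle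
    exact absurd (h.le_of_le ((hb v).1 hv) ((ha u).1 hu) hle).idx_le (not_le.2 hlt)
  · intro x hx z hz y hxy hyz hy
    have hab : ∀ x ∈ boxes (as ++ bs), ∃ k, T x = some k ∧ a ≤ k.idx ∧ k.idx ≤ a + 1 := by
      intro x hx
      obtain ⟨u, hu, rfl⟩ := List.mem_map.1 hx
      rcases List.mem_append.1 hu with hu | hu
      · exact ⟨_, (ha u).1 hu, le_rfl, hlt.le⟩
      · exact ⟨_, (hb u).1 hu, hlt.le, le_rfl⟩
    obtain ⟨k, hk, hk1, -⟩ := hab x hx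
    obtain ⟨k', hk', -, hk2⟩ := hab z hz
    obtain ⟨⟨i, p⟩, hi⟩ := h.exists_letter hk hk' hxy hyz hy
    have h1 : a ≤ i := hk1.trans (h.le_of_le hk hi hxy).idx_le
    have h2 : i ≤ a + 1 := (h.le_of_le hi hk' hyz).idx_le.trans hk2
    refine List.mem_map.2 ⟨(y, p), ?_, rfl⟩
    rw [List.mem_append, ha, hb]
    rcases h1.lt_or_eq with h1 | rfl
    · rw [← PNat.add_one_le_iff] at h1
      rw [le_antisymm h2 h1] at hi
      exact .inr hi
    · exact .inl hi
  · rintro ⟨⟨i, p⟩, hk, hi⟩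
    simp only at hi
    subst hi
    exact h1 (List.mem_map.2 ⟨(x, p), (ha _).2 hk, rfl⟩)
  · rintro ⟨⟨i, p⟩, hk, hi⟩
    simp only at hi
    subst hi
    exact h2 (List.mem_map.2 ⟨(x, p), (hb _).2 hk, rfl⟩)

end

/-! ### The boxes changed by a Bender–Knuth move -/

/-- `x` is an **a**-box or a **b**-box. -/
def IsInPair (T : Filling) (a b : ℕ+) (x : Box) : Prop := IsIn T a x ∨ IsIn T b x

/-- `T'` arises from `T` by changing the **a**-boxes and **b**-boxes among themselves. -/
def Changes (a b : ℕ+) (T T' : Filling) : Prop :=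
  ∀ x, (¬ IsInPair T a b x → T' x = T x) ∧ (IsInPair T a b x → IsInPair T' a b x)

section
variable {a b : ℕ+} {T T' : Filling}

theorem Changes.refl (T : Filling) : Changes a b T T := fun _ => ⟨fun _ => rfl, id⟩

theorem Changes.trans {T'' : Filling} (h : Changes a b T T') (h' : Changes a b T' T'') :
    Changes a b T T'' := fun x => by
  refine ⟨fun hx => ?_, fun hx => (h' x).2 ((h x).2 hx)⟩
  have e := (h x).1 hx
  rw [(h' x).1, e]
  simpa [IsInPair, IsIn, e] using hx

theorem Changes.exchange {x y : Box} (hx : IsInPair T a b x) (hy : IsInPair T a b y) :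
    Changes a b T (exchange T x y) := fun w => by
  by_cases h1 : w = x
  · subst h1
    exact ⟨fun h => absurd hx h, fun _ => by
      simpa [IsInPair, IsIn, ShiftedBK.exchange] using hy⟩
  · by_cases h2 : w = y
    · subst h2
      exact ⟨fun h => absurd hy h, fun _ => by
        simpa [IsInPair, IsIn, ShiftedBK.exchange] using hx⟩
    · have e : ShiftedBK.exchange T x y w = T w := by
        simp [ShiftedBK.exchange, Equiv.swap_apply_of_ne_of_ne h1 h2]
      simp [IsInPair, IsIn, e]

theorem Changes.update {x : Box} {k : Letter} (hx : IsInPair T a b x)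
    (hk : k.idx = a ∨ k.idx = b) (h : Changes a b T T') :
    Changes a b T (Function.update T' x (some k)) := fun w => by
  by_cases h1 : w = x
  · subst h1
    exact ⟨fun h => absurd hx h, fun _ => by simpa [IsInPair, IsIn] using hk⟩
  · have e : Function.update T' x (some k) w = T' w := Function.update_of_ne h1 _ _
    simpa [IsInPair, IsIn, e] using h w

theorem Changes.switchAt {x : Box} (h : CanSwitch T a b x) :
    Changes a b T (switchAt T a b x) := by
  obtain ⟨hx, hrb⟩ := h
  have hx' : IsInPair T a b x := .inl hx
  unfold ShiftedBK.switchAt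
  split_ifs with h1 h2 h3 h4 h5 h6
  · exact .exchange hx' (.inr h1.1)
  · exact .update hx' (.inl rfl) (.exchange (.inl h3.2.2) (.inr h1.2))
  · exact .exchange hx' (.inr h1.2)
  · exact .update (.inr h4) (.inr rfl) (.exchange hx' (.inr h5.2.2))
  · exact .exchange hx' (.inr h4)
  · exact .update hx' (.inl rfl) (.exchange (.inl h6.2.2) (.inr (hrb.resolve_left h4)))
  · exact .exchange hx' (.inr (hrb.resolve_left h4))

theorem Changes.switchStep (T : Filling) : Changes a b T (switchStep a b T) := by
  unfold ShiftedBK.switchStep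
  split_ifs with h
  · exact .switchAt h.choose_spec.1
  · exact .refl T

theorem Changes.switching (T : Filling) : Changes a b T (switching a b T) := by
  unfold ShiftedBK.switching
  generalize sInf {m : ℕ | FullySwitched ((ShiftedBK.switchStep a b)^[m] T) a b} = m
  induction m with
  | zero => exact .refl T
  | succ m ih =>
    rw [Function.iterate_succ_apply']
    exact ih.trans (.switchStep _)

/-- The filling `T` with only the letters **a** and **b** kept. -/
def keep (a b : ℕ+) (T : Filling) : Filling :=
  fun x => (T x).filter fun k => decide (k.idx = a ∨ k.idx = b)

theorem keep_eq_some {x : Box} {k : Letter} :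
    keep a b T x = some k ↔ T x = some k ∧ (k.idx = a ∨ k.idx = b) := by
  simp [keep, Option.filter_eq_some_iff]

theorem isIn_keep_left : IsIn (keep a b T) a = IsIn T a := by
  funext x
  simp only [IsIn, keep_eq_some, eq_iff_iff]
  exact exists_congr fun k => by tauto

theorem isIn_keep_right : IsIn (keep a b T) b = IsIn T b := by
  funext x
  simp only [IsIn, keep_eq_some, eq_iff_iff]
  exact exists_congr fun k => by tauto

theorem canSwitch_keep : CanSwitch (keep a b T) a b = CanSwitch T a b := by
  funext x
  simp only [CanSwitch, isIn_keep_left, isIn_keep_right]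

theorem isNext_keep : IsNext (keep a b T) a b = IsNext T a b := by
  funext x
  simp [IsNext, canSwitch_keep, keep_eq_some]

theorem keep_exchange (x y : Box) : keep a b (exchange T x y) = exchange (keep a b T) x y := rfl

theorem keep_update {x : Box} {k : Letter} (hk : k.idx = a ∨ k.idx = b) :
    keep a b (Function.update T x (some k)) = Function.update (keep a b T) x (some k) := by
  funext w
  by_cases h : w = x
  · subst h
    rw [Function.update_self, keep_eq_some]
    simp [hk]
  · simp [keep, Function.update_of_ne h]

theorem switchAt_keep (x : Box) : switchAt (keep a b T) a b x = keep a b (switchAt T a b x) := by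
  have h1 : keep a b T (right x) = some ⟨b, true⟩ ↔ T (right x) = some ⟨b, true⟩ := by
    simp [keep_eq_some]
  have h2 : AfterDiagonal (keep a b T) a x = AfterDiagonal T a x := by
    simp [AfterDiagonal, keep_eq_some, isIn_keep_left]
  rw [switchAt, switchAt, isIn_keep_right, h2]
  split_ifs
  all_goals first
    | exact (keep_exchange ..).symm
    | (rw [keep_update (by simp), keep_exchange]; done)
    | (exfalso; tauto)

theorem switchStep_keep (T : Filling) : switchStep a b (keep a b T) = keep a b (switchStep a b T) := by
  unfold switchStep
  -- The step depends on a chosen witness, so the predicate is generalized to let the equality of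
  -- predicates be substituted under `choose`.
  have key : ∀ p : Box → Prop, p = IsNext T a b →
      (open Classical in if h : ∃ x, p x then switchAt (keep a b T) a b h.choose else keep a b T) =
        keep a b (open Classical in
          if h : ∃ x, IsNext T a b x then switchAt T a b h.choose else T) := by
    rintro p rfl
    split_ifs
    · exact switchAt_keep _
    · rfl
  exact key _ isNext_keep

theorem switching_keep (T : Filling) : switching a b (keep a b T) = keep a b (switching a b T) := by
  have key : ∀ m, (switchStep a b)^[m] (keep a b T) = keep a b ((switchStep a b)^[m] T) := fun m => by
    induction m with
    | zero => rfl
    | succ m ih => rw [Function.iterate_succ_apply', Function.iterate_succ_apply', ih, switchStep_keep]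
  simp only [switching, key, FullySwitched, canSwitch_keep]

end

/-! ### Relations between the moves -/

section
variable {i j : ℕ+} {T : Filling}

theorem relabel_apply_of_not {x : Box} (h : ¬ IsInPair T i (i + 1) x) : relabel i T x = T x := by
  unfold relabel
  match hT : T x with
  | none => rfl
  | some k =>
    have h1 : k.idx ≠ i := fun e => h (.inl ⟨k, hT, e⟩)
    have h2 : k.idx ≠ i + 1 := fun e => h (.inr ⟨k, hT, e⟩)
    simp [Equiv.swap_apply_of_ne_of_ne h1 h2]

theorem relabel_eq_some {x : Box} {c : ℕ+} {p : Bool} :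
    relabel i T x = some ⟨c, p⟩ ↔ T x = some ⟨Equiv.swap i (i + 1) c, p⟩ := by
  simp only [relabel, Option.map_eq_some_iff, Letter.mk.injEq]
  constructor
  · rintro ⟨k, hk, rfl, rfl⟩
    simpa using hk
  · intro h
    exact ⟨_, h, by simp, rfl⟩

theorem isIn_relabel {x : Box} {c : ℕ+} :
    IsIn (relabel i T) c x ↔ IsIn T (Equiv.swap i (i + 1) c) x := by
  constructor
  · rintro ⟨⟨c, p⟩, h, rfl⟩
    exact ⟨_, relabel_eq_some.1 h, rfl⟩
  · rintro ⟨⟨d, p⟩, h, hd⟩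
    simp only at hd
    subst hd
    exact ⟨_, relabel_eq_some.2 h, rfl⟩

theorem Changes.benderKnuth (T : Filling) : Changes i (i + 1) T (benderKnuth i T) := by
  refine (Changes.switching (a := i) (b := i + 1) T).trans fun x => ⟨relabel_apply_of_not, ?_⟩
  unfold IsInPair ShiftedBK.benderKnuth
  rw [isIn_relabel, isIn_relabel]
  simpa using Or.symm

theorem Standard.benderKnuth {as bs : List LBox} (h : Standard i (i + 1) T as bs) :
    ∃ as' bs', Standard i (i + 1) (benderKnuth i T) bs' as' ∧
      (boxes bs', boxes as') = passAll (boxes as) (boxes bs) [] := by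
  obtain ⟨as', bs', h1, h2⟩ := h.switching (PNat.lt_add_right i 1).ne
  refine ⟨as', bs', ⟨h1.lin, h1.inner, h1.inner_last, h1.outer, h1.outer_last, ?_⟩, h2⟩
  refine ⟨fun u hu => ?_, fun u hu => ?_, fun x hx hx' => ?_⟩
  · exact relabel_eq_some.2 (by simpa using h1.rep.inner u hu)
  · exact relabel_eq_some.2 (by simpa using h1.rep.outer u hu)
  · unfold ShiftedBK.benderKnuth
    rw [isIn_relabel, isIn_relabel]
    simpa using h1.rep.rest x hx hx'

/-- Standard switching is an involution on box lists, the primes are determined by these lists, and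
the boxes with other letters do not change. -/
theorem benderKnuth_benderKnuth {l m : StrictPartition} (h : IsShST l m T) (i : ℕ+) :
    benderKnuth i (benderKnuth i T) = T := by
  obtain ⟨as, bs, h0⟩ := h.exists_standard i
  obtain ⟨as', bs', h1, e1⟩ := h0.benderKnuth
  obtain ⟨bs'', as'', h2, e2⟩ := h1.benderKnuth
  have e : (boxes as'', boxes bs'') = (boxes as, boxes bs) := by
    rw [e2, ← passAll_passAll (boxes as) (boxes bs), ← e1]
  rw [Prod.mk.injEq] at e
  have hlin := h0.lin
  rw [boxes, List.map_append] at hlin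
  have ha : as'' = as := eq_of_boxes_eq (LinExt.infix (A := []) hlin) h0.inner h0.inner_last
    h2.inner h2.inner_last e.1
  have hb : bs'' = bs := eq_of_boxes_eq (LinExt.infix (C := []) (by simpa using hlin)) h0.outer
    h0.outer_last h2.outer h2.outer_last e.2
  subst ha hb
  have hne : i ≠ i + 1 := (PNat.lt_add_right i 1).ne
  funext x
  by_cases hx : IsInPair T i (i + 1) x
  · rcases hx with hx | hx
    · obtain ⟨u, hu, rfl⟩ := List.mem_map.1 ((h0.rep.isIn_inner hne x).1 hx)
      rw [h0.rep.inner u hu, h2.rep.inner u hu]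
    · obtain ⟨u, hu, rfl⟩ := List.mem_map.1 ((h0.rep.isIn_outer hne x).1 hx)
      rw [h0.rep.outer u hu, h2.rep.outer u hu]
  · exact ((Changes.benderKnuth T).trans (Changes.benderKnuth _) x).1 hx

/-- On the boxes with letters `i`, `i + 1` the move `𝗍ᵢ` depends on these letters only. -/
theorem benderKnuth_apply_congr {T T' : Filling} (h : keep i (i + 1) T = keep i (i + 1) T') {x : Box}
    (hx : IsInPair T i (i + 1) x) : benderKnuth i T x = benderKnuth i T' x := by
  obtain ⟨k, hk, hk'⟩ : ∃ k, switching i (i + 1) T x = some k ∧ (k.idx = i ∨ k.idx = i + 1) := by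
    rcases (Changes.switching T x).2 hx with ⟨k, h1, h2⟩ | ⟨k, h1, h2⟩
    · exact ⟨k, h1, .inl h2⟩
    · exact ⟨k, h1, .inr h2⟩
  have h1 := keep_eq_some.2 ⟨hk, hk'⟩
  rw [← switching_keep, h, switching_keep, keep_eq_some] at h1
  simp only [benderKnuth, relabel, hk, h1.1]

/-- The letters `i`, `i + 1` are different from the letters `j`, `j + 1`. -/
def Far (i j : ℕ+) : Prop := i + 1 < j ∨ j + 1 < i

theorem Far.symm (h : Far i j) : Far j i := Or.symm h

theorem Far.not_isInPair (h : Far i j) {x : Box} (hx : IsInPair T i (i + 1) x) :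
    ¬ IsInPair T j (j + 1) x := by
  have hn : (i : ℕ) + 1 < j ∨ (j : ℕ) + 1 < i := by
    simpa only [Far, ← PNat.coe_lt_coe, PNat.add_coe, PNat.one_coe] using h
  intro hx'
  rcases hx with ⟨k, hk, e⟩ | ⟨k, hk, e⟩ <;> rcases hx' with ⟨k', hk', e'⟩ | ⟨k', hk', e'⟩ <;>
  · rw [hk, Option.some.injEq] at hk'
    rw [← hk', e] at e'
    have := congrArg (fun n : ℕ+ => (n : ℕ)) e'
    push_cast at this
    omega

theorem Far.keep_benderKnuth (h : Far i j) (T : Filling) :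
    keep i (i + 1) (benderKnuth j T) = keep i (i + 1) T := by
  funext x
  by_cases hx : IsInPair T j (j + 1) x
  · have key : ∀ {T : Filling}, IsInPair T j (j + 1) x → keep i (i + 1) T x = none := by
      intro T hx
      refine Option.eq_none_iff_forall_ne_some.2 fun k hk => ?_
      rw [keep_eq_some] at hk
      refine h.symm.not_isInPair hx ?_
      rcases hk.2 with e | e
      · exact .inl ⟨k, hk.1, e⟩
      · exact .inr ⟨k, hk.1, e⟩
    rw [key hx, key ((Changes.benderKnuth T x).2 hx)]
  · simp only [keep, (Changes.benderKnuth T x).1 hx]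

theorem Far.benderKnuth_apply (h : Far i j) {x : Box} (hx : IsInPair T i (i + 1) x) :
    benderKnuth i (benderKnuth j T) x = benderKnuth j (benderKnuth i T) x := by
  rw [← benderKnuth_apply_congr (h.keep_benderKnuth T).symm hx,
    (Changes.benderKnuth (benderKnuth i T) x).1 (h.not_isInPair ((Changes.benderKnuth T x).2 hx))]

theorem Far.benderKnuth_comm (h : Far i j) (T : Filling) :
    benderKnuth i (benderKnuth j T) = benderKnuth j (benderKnuth i T) := by
  funext x
  by_cases hx : IsInPair T i (i + 1) x
  · exact h.benderKnuth_apply hx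
  · by_cases hx' : IsInPair T j (j + 1) x
    · exact (h.symm.benderKnuth_apply hx').symm
    · have e1 := (Changes.benderKnuth T x).1 hx
      have e2 := (Changes.benderKnuth T x).1 hx'
      rw [(Changes.benderKnuth (benderKnuth j T) x).1 (by simpa [IsInPair, IsIn, e2] using hx),
        (Changes.benderKnuth (benderKnuth i T) x).1 (by simpa [IsInPair, IsIn, e1] using hx'), e1, e2]

end

/-! ### The shifted Berenstein–Kirillov group -/

section
variable {X : Set Filling}

theorem t_eq_of_actWord {u v : List ℕ+} (h : ∀ T ∈ X, actWord u T = actWord v T) :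
    (u.map (t X)).prod = (v.map (t X)).prod := by
  have hmem : (u.map FreeGroup.of).prod * ((v.map FreeGroup.of).prod)⁻¹ ∈ relations X :=
    ⟨u, v, h, rfl⟩
  have := PresentedGroup.one_of_mem hmem
  rw [map_mul, map_inv, mul_inv_eq_one, map_list_prod, map_list_prod, List.map_map,
    List.map_map] at this
  exact this

theorem t_mul_self (hX : X ⊆ skewTableaux) (i : ℕ+) : t X i * t X i = 1 := by
  have := t_eq_of_actWord (X := X) (u := [i, i]) (v := []) fun T hT => by
    obtain ⟨l, m, h⟩ := hX hT
    exact benderKnuth_benderKnuth h i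
  simpa using this

theorem t_comm {i j : ℕ+} (h : Far i j) : t X i * t X j = t X j * t X i := by
  have := t_eq_of_actWord (X := X) (u := [i, j]) (v := [j, i]) fun T _ => h.benderKnuth_comm T
  simpa using this

/-- The products `𝗉ₙ`, with `𝗉₀ = 1`. -/
def pNat (X : Set Filling) (n : ℕ) : SBK X :=
  ((List.range n).reverse.map fun k => t X k.succPNat).prod

/-- The products `𝗊ₙ`, with `𝗊₀ = 1`. -/
def qNat (X : Set Filling) (n : ℕ) : SBK X :=
  ((List.range n).map fun k => p X k.succPNat).prod

theorem pNat_succ (n : ℕ) : pNat X (n + 1) = t X n.succPNat * pNat X n := by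
  simp [pNat, List.range_succ]

theorem qNat_succ (n : ℕ) : qNat X (n + 1) = qNat X n * pNat X (n + 1) := by
  simp [qNat, List.range_succ, p, pNat]

theorem commute_pNat {n k : ℕ} (h : n < k) : Commute (t X k.succPNat) (pNat X n) := by
  induction n with
  | zero => simp [pNat]
  | succ n ih =>
    rw [pNat_succ]
    refine Commute.mul_right (t_comm (.inr ?_)) (ih (by omega))
    rw [← PNat.coe_lt_coe]
    simp only [PNat.add_coe, PNat.one_coe, Nat.succPNat_coe]
    omega

theorem commute_qNat {n k : ℕ} (h : n < k) : Commute (t X k.succPNat) (qNat X n) := by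
  induction n with
  | zero => simp [qNat]
  | succ n ih =>
    rw [qNat_succ]
    exact Commute.mul_right (ih (by omega)) (commute_pNat h)

/-- Induction: $p_{n+2}q_{n+2}=t_{n+2}(p_{n+1}q_{n+1})p_{n+2}=t_{n+2}q_nt_{n+2}p_{n+1}=q_np_{n+1}$,
as $t_{n+2}$ is an involution commuting with $q_n$. -/
theorem pNat_mul_qNat (hX : X ⊆ skewTableaux) (n : ℕ) :
    pNat X (n + 1) * qNat X (n + 1) = qNat X n := by
  induction n with
  | zero =>
    have e : pNat X 0 = 1 := rfl
    have e' : qNat X 0 = 1 := rfl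
    rw [qNat_succ, pNat_succ, e, e', mul_one, one_mul, t_mul_self hX]
  | succ n ih =>
    have hc := (commute_qNat (X := X) (Nat.lt_succ_self n)).eq
    have ht := t_mul_self hX (n + 1).succPNat
    have h2 : pNat X (n + 1 + 1) * qNat X (n + 1 + 1) =
        t X (n + 1).succPNat * (pNat X (n + 1) * qNat X (n + 1)) * pNat X (n + 1 + 1) := by
      rw [qNat_succ (n + 1), pNat_succ (n + 1)]
      simp only [mul_assoc]
    rw [h2, ih, pNat_succ (n + 1), hc, qNat_succ n, mul_assoc, ← mul_assoc (t X _), ht, one_mul]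

theorem qNat_mul_self (hX : X ⊆ skewTableaux) (n : ℕ) : qNat X n * qNat X n = 1 := by
  induction n with
  | zero => simp [qNat]
  | succ n ih =>
    conv_lhs => enter [1]; rw [qNat_succ]
    rw [mul_assoc, pNat_mul_qNat hX, ih]

/-- The uniform formula for $t_{n+2}$: the convention $q_0=1$ absorbs the special case $t_2$. -/
theorem t_eq_qNat (hX : X ⊆ skewTableaux) (n : ℕ) :
    t X (n + 1).succPNat = qNat X (n + 1) * qNat X (n + 2) * qNat X (n + 1) * qNat X n := by
  rw [qNat_succ (n + 1), ← mul_assoc, qNat_mul_self hX, one_mul, pNat_succ, ← pNat_mul_qNat hX n]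
  have h : pNat X (n + 1) * qNat X (n + 1) * pNat X (n + 1) * qNat X (n + 1) = 1 := by
    rw [pNat_mul_qNat hX, mul_assoc, pNat_mul_qNat hX, qNat_mul_self hX]
  have h' : pNat X (n + 1) * qNat X (n + 1) * (pNat X (n + 1) * qNat X (n + 1)) = 1 := by
    rw [← mul_assoc, h]
  rw [mul_assoc (t X _), mul_assoc (t X _), h', mul_one]

theorem pNat_mem {H : Subgroup (SBK X)} {n : ℕ} (h : ∀ k < n, t X k.succPNat ∈ H) :
    pNat X n ∈ H := by
  induction n with
  | zero => simp [pNat]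
  | succ n ih =>
    rw [pNat_succ]
    exact H.mul_mem (h n (by omega)) (ih fun k hk => h k (by omega))

theorem qNat_mem {H : Subgroup (SBK X)} {n : ℕ} (h : ∀ k < n, t X k.succPNat ∈ H) :
    qNat X n ∈ H := by
  induction n with
  | zero => simp [qNat]
  | succ n ih =>
    rw [qNat_succ]
    exact H.mul_mem (ih fun k hk => h k (by omega)) (pNat_mem h)

theorem q_eq_qNat (i : ℕ+) : q X i = qNat X i := rfl

theorem t_one_eq : t X 1 = qNat X 1 := by
  simp only [qNat_succ 0, pNat_succ 0]
  simp [qNat, pNat]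
  rfl

theorem straightTableaux_subset : straightTableaux ⊆ skewTableaux := fun _ ⟨l, h⟩ => ⟨l, _, h⟩

theorem generators_eq (hX' : X ⊆ skewTableaux) :
    t X 1 = q X 1 ∧ t X 2 = q X 1 * q X 2 * q X 1 ∧
    (∀ i : ℕ+, 2 < i → t X i = q X (i - 1) * q X i * q X (i - 1) * q X (i - 2)) ∧
    ∀ n : ℕ, SBKn X n = Subgroup.closure {g | ∃ i : ℕ+, (i : ℕ) ≤ n - 1 ∧ g = q X i} := by
  refine ⟨t_one_eq, ?_, fun i hi => ?_, fun n => le_antisymm ?_ ?_⟩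
  · have h := t_eq_qNat hX' 0
    rw [show qNat X 0 = 1 from rfl, mul_one] at h
    exact h
  · have hi' : 2 < (i : ℕ) := by exact_mod_cast hi
    obtain ⟨n, hn⟩ : ∃ n, (i : ℕ) = n + 3 := ⟨i - 3, by omega⟩
    have h := t_eq_qNat hX' (n + 1)
    have e0 : (n + 1 + 1).succPNat = i := PNat.eq (by rw [Nat.succPNat_coe, hn])
    -- Subtraction on `ℕ+` has the default value 1; since $i>2$, the differences here are the true
    -- ones.
    have e1 : ((i - 1 : ℕ+) : ℕ) = n + 2 := by
      rw [PNat.sub_coe, if_pos ((by decide : (1 : ℕ+) < 2).trans hi), hn]; rfl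
    have e2 : ((i - 2 : ℕ+) : ℕ) = n + 1 := by
      rw [PNat.sub_coe, if_pos hi, hn]; rfl
    rw [q_eq_qNat, q_eq_qNat, q_eq_qNat, e1, e2, hn, ← h, e0]
  · rw [SBKn, Subgroup.closure_le]
    rintro _ ⟨i, hi, rfl⟩
    have hq : ∀ k, k ≤ n - 1 →
        qNat X k ∈ Subgroup.closure {g | ∃ i : ℕ+, (i : ℕ) ≤ n - 1 ∧ g = q X i} := fun k hk => by
      match k with
      | 0 => exact Subgroup.one_mem _
      | k + 1 => exact Subgroup.subset_closure ⟨k.succPNat, hk, rfl⟩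
    obtain ⟨k, rfl⟩ : ∃ k : ℕ, i = k.succPNat := ⟨i.natPred, by simp⟩
    rw [Nat.succPNat_coe] at hi
    match k with
    | 0 =>
      have : t X (Nat.succPNat 0) = qNat X 1 := t_one_eq
      rw [SetLike.mem_coe, this]
      exact hq 1 hi
    | k + 1 =>
      rw [SetLike.mem_coe, t_eq_qNat hX']
      exact mul_mem (mul_mem (mul_mem (hq _ (by omega)) (hq _ (by omega))) (hq _ (by omega)))
        (hq _ (by omega))
  · rw [Subgroup.closure_le]
    rintro _ ⟨i, hi, rfl⟩
    refine qNat_mem fun k hk => Subgroup.subset_closure ⟨k.succPNat, ?_, rfl⟩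
    rw [Nat.succPNat_coe]
    omega

end

end ShiftedBK

/-- `X` is either the class of all (skew) shifted semistandard tableaux in canonical form, or its
subclass of tableaux of straight shape; the result is stated for the group of either class. -/
theorem mainTheorem5 (X : Set ShiftedBK.Filling)
    (hX : X = ShiftedBK.skewTableaux ∨ X = ShiftedBK.straightTableaux) :
    ShiftedBK.t X 1 = ShiftedBK.q X 1 ∧
    ShiftedBK.t X 2 = ShiftedBK.q X 1 * ShiftedBK.q X 2 * ShiftedBK.q X 1 ∧
    (∀ i : ℕ+, 2 < i →
      ShiftedBK.t X i =
        ShiftedBK.q X (i - 1) * ShiftedBK.q X i * ShiftedBK.q X (i - 1) * ShiftedBK.q X (i - 2)) ∧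
    ∀ n : ℕ, ShiftedBK.SBKn X n =
      Subgroup.closure {g | ∃ i : ℕ+, (i : ℕ) ≤ n - 1 ∧ g = ShiftedBK.q X i} := by
  rcases hX with rfl | rfl
  · exact ShiftedBK.generators_eq subset_rfl
  · exact ShiftedBK.generators_eq ShiftedBK.straightTableaux_subset
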